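/- Let $q=2^r$ with $r\ge 1$, let $\mathbb{F}_q$ be the field with $q$ elements, let $\mathrm{tr}(x)=x+x^2+\cdots+x^{2^{r-1}}$ be the trace function $\mathbb{F}_q\to\mathbb{F}_2$, and let $\lambda(x)=(-1)^{\mathrm{tr}(x)}$ be the canonical additive character of $\mathbb{F}_q$. For $a\in\mathbb{F}_q^*$ put $$K_m(\lambda;a)=\sum_{\alpha_1,\dots,\alpha_m\in\mathbb{F}_q^*}\lambda(\alpha_1+\cdots+\alpha_m+a\,\alpha_1^{-1}\cdots\alpha_m^{-1}),\qquad K(\lambda;a)=K_1(\lambda;a).$$ For $n\ge 1$ let $P^+=P^+(2n,q)$ be the maximal parabolic subgroup of the orthogonal group $O^+(2n,q)$ of the quadratic form $\sum_{i=1}^n x_ix_{n+i}$ that consists of all matrices $$\begin{bmatrix}A&0\\0&{}^tA^{-1}\end{bmatrix}\begin{bmatrix}1_n&B\\0&1_n\end{bmatrix},\qquad A\in GL(n,q),\ B\text{ an alternating } n\times n\text{ matrix over }\mathbb{F}_q,$$ and for $0\le s\le n$ let $$\sigma_s^+=\begin{bmatrix}0&0&1_s&0\\0&1_{n-s}&0&0\\1_s&0&0&0\\0&0&0&1_{n-s}\end{bmatrix}.$$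 Let $DC_1^+(n,q)=P^+\sigma_{n-1}^+P^+$ and $DC_2^+(n,q)=P^+\sigma_{n-2}^+P^+$ for $n=2,4,6,\dots$, let $DC_1^-(n,q)=P^+\sigma_{n-1}^+P^+$ for $n=1,3,5,\dots$, and let $DC_2^-(n,q)=P^+\sigma_{n-2}^+P^+$ for $n=3,5,7,\dots$. With $\left[{n\atop s}\right]_q=\prod_{j=0}^{s-1}(q^{n-j}-1)/(q^{s-j}-1)$, put $$A_1^+(n,q)=q^{\frac14(5n^2-6n)}\left[{n\atop 1}\right]_q\prod_{j=1}^{n/2}(q^{2j-1}-1),\qquad A_2^+(n,q)=q^{\frac14(5n^2-6n)}\left[{n\atop 2}\right]_q\prod_{j=1}^{(n-2)/2}(q^{2j-1}-1),$$ $$A_1^-(n,q)=q^{\frac14(5n^2-4n-1)}\left[{n\atop 1}\right]_q\prod_{j=1}^{(n-1)/2}(q^{2j-1}-1),\qquad A_2^-(n,q)=q^{\frac14(5n^2-8n+3)}\left[{n\atop 2}\right]_q\prod_{j=1}^{(n-1)/2}(q^{2j-1}-1).$$ Then for every $a\in\mathbb{F}_q^*$, with either $+$ signs or $-$ signs chosen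 everywhere, and for every $n$ for which the double coset in question is defined, $$\sum_{w\in DC_1^\pm(n,q)}\lambda(a\,\mathrm{Tr}\,w)=A_1^\pm(n,q)\,K(\lambda;a),$$ $$\sum_{w\in DC_2^\pm(n,q)}\lambda(a\,\mathrm{Tr}\,w)=A_2^\pm(n,q)\left(K(\lambda;a)^2+q^2-q\right)=A_2^\pm(n,q)\left(K_2(\lambda;a)+q^2\right),$$ where $\mathrm{Tr}\,w$ is the trace of the matrix $w$. -/

import Mathlib

open Matrix

/-- The absolute trace `tr : 𝔽_q → 𝔽₂` of a finite field of characteristic two. -/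
noncomputable def absTr (F : Type*) [Field F] [Algebra (ZMod 2) F] (x : F) : ZMod 2 :=
  Algebra.trace (ZMod 2) F x

/-- The canonical additive character `λ(x) = (-1)^{tr x}` of `𝔽_q`, `q` a power of two. -/
noncomputable def canonicalChar (F : Type*) [Field F] [Algebra (ZMod 2) F] : AddChar F ℂ where
  toFun x := (-1) ^ (absTr F x).val
  map_zero_eq_one' := by simp [absTr]
  map_add_eq_mul' x y := by
    have h := (AddChar.zmodChar 2 (by norm_num : (-1 : ℂ) ^ 2 = 1)).map_add_eq_mul
      (absTr F x) (absTr F y)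
    simpa only [AddChar.zmodChar_apply, absTr, map_add] using h

/-- `tr x = x + x² + ⋯ + x^{2^{r-1}}` when `𝔽_q` has `2^r` elements. -/
theorem absTr_eq_sum (F : Type*) [Field F] [Fintype F] [Algebra (ZMod 2) F] (r : ℕ)
    (hq : Fintype.card F = 2 ^ r) (x : F) :
    algebraMap (ZMod 2) F (absTr F x) = ∑ i ∈ Finset.range r, x ^ (2 ^ i) := by
  have hr : Module.finrank (ZMod 2) F = r := by
    have h := Module.card_eq_pow_finrank (K := ZMod 2) (V := F)
    rw [hq, ZMod.card] at h
    exact (Nat.pow_right_injective le_rfl h).symm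
  rw [absTr, FiniteField.algebraMap_trace_eq_sum_pow, hr, Nat.card_zmod]

/-- The `m`-dimensional Kloosterman sum
`K_m(ψ; a) = ∑_{α₁, …, α_m ∈ 𝔽_q^*} ψ(α₁ + ⋯ + α_m + a α₁⁻¹ ⋯ α_m⁻¹)`. -/
noncomputable def kloostermanSum {F : Type*} [Field F] [Fintype F] [DecidableEq F] (m : ℕ)
    (ψ : AddChar F ℂ) (a : F) : ℂ :=
  ∑ α : Fin m → Fˣ, ψ (∑ i, (α i : F) + a * ∏ i, (α i : F)⁻¹)

/-- An alternating matrix: skew-symmetric with zero diagonal. -/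
def IsAlternatingMatrix {F : Type*} [Field F] {n : ℕ} (B : Matrix (Fin n) (Fin n) F) : Prop :=
  (∀ i, B i i = 0) ∧ ∀ i j, B i j = -B j i

/-- The maximal parabolic subgroup `P⁺(2n,q)` of `O⁺(2n,q)`, as a set of matrices:
all products `[A, 0; 0, ᵗA⁻¹] [1, B; 0, 1]` with `A ∈ GL(n,q)` and `B` alternating. -/
def parabolicPlus (n : ℕ) (F : Type*) [Field F] :
    Set (Matrix (Fin n ⊕ Fin n) (Fin n ⊕ Fin n) F) :=
  {w | ∃ (A : GL (Fin n) F) (B : Matrix (Fin n) (Fin n) F), IsAlternatingMatrix B ∧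
    w = fromBlocks (A : Matrix (Fin n) (Fin n) F) 0 0
          ((A⁻¹ : GL (Fin n) F) : Matrix (Fin n) (Fin n) F)ᵀ * fromBlocks 1 B 0 1}

/-- The matrix `σ_r⁺`, which exchanges `e^i` and `e^{n+i}` for the first `r` indices `i`
and fixes the other standard basis vectors. -/
def sigmaPlus (n r : ℕ) (F : Type*) [Field F] : Matrix (Fin n ⊕ Fin n) (Fin n ⊕ Fin n) F :=
  fromBlocks
    (diagonal fun i => if i.val < r then 0 else 1) (diagonal fun i => if i.val < r then 1 else 0)
    (diagonal fun i => if i.val < r then 1 else 0) (diagonal fun i => if i.val < r then 0 else 1)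

/-- The (finite) double coset `P⁺ σ_r⁺ P⁺`. -/
noncomputable def bruhatCell (n r : ℕ) (F : Type*) [Field F] [Fintype F] :
    Finset (Matrix (Fin n ⊕ Fin n) (Fin n ⊕ Fin n) F) :=
  (Set.toFinite
    (DoubleCoset.doubleCoset (sigmaPlus n r F) (parabolicPlus n F) (parabolicPlus n F))).toFinset

/-- `DC₁^±(n,q) = P⁺ σ_{n-1}⁺ P⁺`; the sign is `+` for `n` even and `-` for `n` odd. -/
noncomputable def DC₁ (n : ℕ) (F : Type*) [Field F] [Fintype F] :
    Finset (Matrix (Fin n ⊕ Fin n) (Fin n ⊕ Fin n) F) :=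
  bruhatCell n (n - 1) F

/-- `DC₂^±(n,q) = P⁺ σ_{n-2}⁺ P⁺`; the sign is `+` for `n` even and `-` for `n` odd. -/
noncomputable def DC₂ (n : ℕ) (F : Type*) [Field F] [Fintype F] :
    Finset (Matrix (Fin n ⊕ Fin n) (Fin n ⊕ Fin n) F) :=
  bruhatCell n (n - 2) F

/-- The `q`-binomial coefficient `∏_{j=0}^{r-1} (q^{n-j} - 1) / (q^{r-j} - 1)`. -/
noncomputable def qBinom (q n r : ℕ) : ℂ :=
  ∏ j ∈ Finset.range r, (((q : ℂ) ^ (n - j) - 1) / ((q : ℂ) ^ (r - j) - 1))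

/-- `A₁⁺(n,q)`, for `n = 2, 4, 6, …`. -/
noncomputable def A₁plus (n q : ℕ) : ℂ :=
  (q : ℂ) ^ ((5 * n ^ 2 - 6 * n) / 4) * qBinom q n 1 *
    ∏ j ∈ Finset.Icc 1 (n / 2), ((q : ℂ) ^ (2 * j - 1) - 1)

/-- `A₂⁺(n,q)`, for `n = 2, 4, 6, …`. -/
noncomputable def A₂plus (n q : ℕ) : ℂ :=
  (q : ℂ) ^ ((5 * n ^ 2 - 6 * n) / 4) * qBinom q n 2 *
    ∏ j ∈ Finset.Icc 1 ((n - 2) / 2), ((q : ℂ) ^ (2 * j - 1) - 1)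

/-- `A₁⁻(n,q)`, for `n = 1, 3, 5, …`. -/
noncomputable def A₁minus (n q : ℕ) : ℂ :=
  (q : ℂ) ^ ((5 * n ^ 2 - 4 * n - 1) / 4) * qBinom q n 1 *
    ∏ j ∈ Finset.Icc 1 ((n - 1) / 2), ((q : ℂ) ^ (2 * j - 1) - 1)

/-- `A₂⁻(n,q)`, for `n = 3, 5, 7, …`. -/
noncomputable def A₂minus (n q : ℕ) : ℂ :=
  (q : ℂ) ^ ((5 * n ^ 2 - 8 * n + 3) / 4) * qBinom q n 2 *
    ∏ j ∈ Finset.Icc 1 ((n - 1) / 2), ((q : ℂ) ^ (2 * j - 1) - 1)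

/-!
The trace character `w ↦ ψ (a tr w)` is a class function, so its sum over the double coset `P σ P`
reduces to a single sum over `P`: by `card_mul_sum_doubleCoset`, `|H| ∑_{w ∈ P σ P} ψ (a tr w)`
equals `|P| ∑_{p ∈ P} ψ (a tr (p σ))`, where `H` consists of the `h ∈ P` with `σ⁻¹ h σ ∈ P`. The
rows and columns are split as `m ⊕ k`, where `σ` exchanges the two copies of the basis vectors
indexed by `m` and fixes those indexed by `k` (`k` has one element for `DC₁` and two for `DC₂`).

An element of `P` is a pair `(A, B)` with `A` invertible and `B` alternating. It lies in `H` exactly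
when the upper right block of `A` and the upper left block of `B` vanish
(`conj_sigmaElt_mem_parabolic_iff`): the parabolic subgroup consists of the isometries of the
quadratic form with vanishing lower left block, and `σ` is an isometry. In the sum over `p = (A, B)`
the matrix `B` enters linearly. Alternating matrices are orthogonal to precisely the symmetric ones
under the trace form, so the sum over `B` vanishes unless `A = [S, 0; X, C]` with `S` symmetric, and
then the summand is `ψ (a (tr C + tr C⁻¹))` (`sum_parabolic_addChar`).

Three evaluations remain.
* The number of invertible symmetric matrices: bordering a symmetric matrix by one row and column,
  and taking a Schur complement when the corner is nonzero, gives a two-step recursion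
  (`symmUnitCount_fin_add_two`).
* The sums of `ψ (a (tr C + tr C⁻¹))` over `GL₁` and `GL₂` (`sum_GL_one`, `sum_GL_two`), which are
  expressed by the Kloosterman sum because `ψ` is invariant under squaring.
* Carlitz's identity `K₂ = K² - q` in characteristic two (`kloostermanSum_two_eq`), which rests on
  `u² + u = t` having `1 + ψ t` solutions.
-/

/-! ### Character sums over a field of characteristic two -/

section CharacterSums

variable {F : Type*} [Field F] [Fintype F]

theorem canonicalChar_sq [Algebra (ZMod 2) F] (x : F) :
    canonicalChar F (x ^ 2) = canonicalChar F x := by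
  have h : absTr F (x ^ 2) = absTr F x := by
    have := Algebra.trace_eq_of_algEquiv (FiniteField.frobeniusAlgEquivOfAlgebraic (ZMod 2) F) x
    simpa [absTr, ZMod.card] using this
  change (-1 : ℂ) ^ (absTr F (x ^ 2)).val = (-1) ^ (absTr F x).val
  rw [h]

theorem canonicalChar_isPrimitive [Algebra (ZMod 2) F] : (canonicalChar F).IsPrimitive := by
  refine AddChar.IsPrimitive.of_ne_one fun h => ?_
  obtain ⟨x, hx⟩ := Algebra.trace_surjective (ZMod 2) F 1
  have h1 : canonicalChar F x = 1 := by rw [h]; rfl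
  have h2 : canonicalChar F x = (-1) ^ (absTr F x).val := rfl
  have h3 : (1 : ZMod 2).val = 1 := rfl
  rw [h2, absTr, hx, h3] at h1
  norm_num at h1

variable [DecidableEq F]

theorem sum_units_eq_sum_ite (f : F → ℂ) :
    ∑ x : Fˣ, f x = ∑ x : F, if x = 0 then 0 else f x := by
  have h : ∑ x : F, (if x = 0 then 0 else f x) =
      ∑ x ∈ Finset.univ.filter (fun x : F => x ≠ 0), f x := by
    rw [Finset.sum_filter]
    exact Finset.sum_congr rfl fun x _ => by by_cases hx : x = 0 <;> simp [hx]
  rw [h]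
  refine Finset.sum_bij (fun x _ => (x : F)) (by simp) (by simp [Units.val_inj]) ?_ (by simp)
  intro b hb
  exact ⟨Units.mk0 b (by simpa using hb), by simp, rfl⟩

variable {ψ : AddChar F ℂ}

theorem kloostermanSum_one (a : F) :
    kloostermanSum 1 ψ a = ∑ x : Fˣ, ψ (x + a * (x : F)⁻¹) := by
  rw [kloostermanSum, ← (Equiv.funUnique (Fin 1) Fˣ).symm.sum_comp]
  simp

theorem kloostermanSum_two (a : F) :
    kloostermanSum 2 ψ a =
      ∑ x : Fˣ, ∑ y : Fˣ, ψ (x + y + a * ((x : F)⁻¹ * (y : F)⁻¹)) := by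
  rw [kloostermanSum, ← (finTwoArrowEquiv Fˣ).symm.sum_comp, Fintype.sum_prod_type]
  simp [Fin.sum_univ_two, Fin.prod_univ_two, mul_comm]

theorem sum_units_addChar (hψ : ψ.IsPrimitive) {b : F} (hb : b ≠ 0) :
    ∑ x : Fˣ, ψ (x * b) = -1 := by
  rw [sum_units_eq_sum_ite fun x => ψ (x * b)]
  have h := AddChar.sum_mulShift b hψ
  rw [if_neg hb] at h
  rw [← Finset.add_sum_erase _ _ (Finset.mem_univ (0 : F))] at h ⊢
  rw [Finset.sum_congr rfl fun x hx => if_neg (Finset.ne_of_mem_erase hx)]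
  simp only [zero_mul, AddChar.map_zero_eq_one] at h
  rw [if_pos rfl, zero_add]
  linear_combination h

/-- The equation `u² + u = t` has `1 + ψ t` solutions. Detecting it by the characters
`x ↦ ψ (c x)`, the invariance of `ψ` under squaring turns the sum over `u` into
`∑ u, ψ ((c + c²) u²)`, so only `c = 0` and `c = 1` contribute. -/
theorem sum_comp_sq_add_self [CharP F 2] (hψ : ψ.IsPrimitive) (hsq : ∀ x, ψ (x ^ 2) = ψ x)
    (g : F → ℂ) : ∑ u : F, g (u ^ 2 + u) = ∑ t : F, g t * (1 + ψ t) := by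
  have hq : (Fintype.card F : ℂ) ≠ 0 := by exact_mod_cast Fintype.card_ne_zero
  have key : ∀ t : F, (∑ u : F, if u ^ 2 + u = t then (1 : ℂ) else 0) = 1 + ψ t := by
    intro t
    refine mul_left_cancel₀ hq ?_
    have h1 : ∀ u : F, (Fintype.card F : ℂ) * (if u ^ 2 + u = t then (1 : ℂ) else 0)
        = ∑ c : F, ψ (c * (u ^ 2 + u + t)) := by
      intro u
      rw [AddChar.sum_mulShift _ hψ]
      have : u ^ 2 + u + t = 0 ↔ u ^ 2 + u = t := by
        rw [← CharTwo.sub_eq_add _ t, sub_eq_zero]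
      simp [this]
    have h2 : ∀ c : F, ∑ u : F, ψ (c * (u ^ 2 + u + t))
        = ψ (c * t) * if c = 0 ∨ c = 1 then (Fintype.card F : ℂ) else 0 := by
      intro c
      have h3 : ∀ u : F, ψ (c * (u ^ 2 + u + t)) = ψ (c * t) * ψ (u ^ 2 * (c + c ^ 2)) := by
        intro u
        rw [show c * (u ^ 2 + u + t) = c * t + (c * u ^ 2 + c * u) by ring,
          AddChar.map_add_eq_mul, AddChar.map_add_eq_mul, ← hsq (c * u),
          ← AddChar.map_add_eq_mul _ (c * u ^ 2)]
        congr 2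
        ring
      rw [Finset.sum_congr rfl fun u _ => h3 u, ← Finset.mul_sum]
      congr 1
      have h4 : c + c ^ 2 = 0 ↔ c = 0 ∨ c = 1 := by
        rw [show c + c ^ 2 = c * (1 + c) by ring, mul_eq_zero, add_comm, ← CharTwo.sub_eq_add,
          sub_eq_zero]
      have h5 := (frobeniusEquiv F 2).toEquiv.sum_comp fun x => ψ (x * (c + c ^ 2))
      simp only [RingEquiv.toEquiv_eq_coe, EquivLike.coe_coe, frobeniusEquiv_apply,
        frobenius_def] at h5
      rw [h5, AddChar.sum_mulShift _ hψ]
      simp [h4]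
    rw [Finset.mul_sum, Finset.sum_congr rfl fun u _ => h1 u, Finset.sum_comm,
      Finset.sum_congr rfl fun c _ => h2 c]
    have h6 : ∀ c : F, (ψ (c * t) * if c = 0 ∨ c = 1 then (Fintype.card F : ℂ) else 0)
        = (if c = 0 then (Fintype.card F : ℂ) else 0) +
          if c = 1 then ψ t * (Fintype.card F : ℂ) else 0 := by
      intro c
      by_cases h0 : c = 0
      · simp [h0]
      · by_cases h1 : c = 1 <;> simp [h0, h1]
    rw [Finset.sum_congr rfl fun c _ => h6 c, Finset.sum_add_distrib]
    simp
    ring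
  calc ∑ u : F, g (u ^ 2 + u) = ∑ u : F, ∑ t : F, g t * (if u ^ 2 + u = t then (1 : ℂ) else 0) := by
        simp
    _ = ∑ t : F, g t * (1 + ψ t) := by
        rw [Finset.sum_comm]
        exact Finset.sum_congr rfl fun t _ => by rw [← Finset.mul_sum, key]

/-- Carlitz's identity `K₂(a) = K(a)² - q` in characteristic two. Substituting `x = s u` and
`y = s (1 + u)` in the square, the off-diagonal terms depend only on `s` and `u² + u`. -/
theorem kloostermanSum_two_eq [CharP F 2] (hψ : ψ.IsPrimitive) (hsq : ∀ x, ψ (x ^ 2) = ψ x)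
    {a : F} (ha : a ≠ 0) :
    kloostermanSum 2 ψ a = kloostermanSum 1 ψ a ^ 2 - Fintype.card F := by
  -- the summands, extended by zero so that the sums can be reindexed over all of `F`
  let G : F → F → ℂ := fun x y => if x = 0 ∨ y = 0 then 0 else ψ (x + y + a * (x⁻¹ + y⁻¹))
  let g : F → F → ℂ := fun s t => if t = 0 then 0 else ψ (s + a * (s⁻¹ * t⁻¹))
  have hsquare : kloostermanSum 1 ψ a ^ 2 = ∑ s : F, ∑ x : F, G x (s + x) := by
    have h1 : kloostermanSum 1 ψ a ^ 2 = ∑ x : F, ∑ y : F, G x y := by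
      rw [kloostermanSum_one, sum_units_eq_sum_ite fun x => ψ (x + a * x⁻¹), sq,
        Finset.sum_mul_sum]
      refine Finset.sum_congr rfl fun x _ => Finset.sum_congr rfl fun y _ => ?_
      by_cases hx : x = 0
      · simp [G, hx]
      by_cases hy : y = 0
      · simp [G, hy]
      simp only [G, hx, hy, if_false, or_self]
      rw [← AddChar.map_add_eq_mul]
      congr 1
      ring
    rw [h1]
    conv_rhs => rw [Finset.sum_comm]
    exact Finset.sum_congr rfl fun x _ => (Equiv.sum_comp (Equiv.addRight x) (G x)).symm
  have hzero : ∑ x : F, G x (0 + x) = Fintype.card F - 1 := by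
    have h : ∀ x : F, G x (0 + x) = 1 - if x = 0 then 1 else 0 := by
      intro x
      by_cases hx : x = 0
      · simp [G, hx]
      · simp [G, hx, CharTwo.add_self_eq_zero]
    rw [Finset.sum_congr rfl fun x _ => h x, Finset.sum_sub_distrib]
    simp
  have hne : ∀ s : F, s ≠ 0 → ∑ x : F, G x (s + x) = ∑ t : F, g s t * (1 + ψ t) := by
    intro s hs
    rw [← sum_comp_sq_add_self hψ hsq, ← Equiv.sum_comp (Equiv.mulLeft₀ s hs)]
    refine Finset.sum_congr rfl fun u _ => ?_
    change G (s * u) (s + s * u) = g s (u ^ 2 + u)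
    have hu : u ^ 2 + u = u * (1 + u) := by ring
    by_cases h0 : u = 0
    · simp [G, g, h0]
    by_cases h1 : 1 + u = 0
    · have h2 : s + s * u = 0 := by rw [← mul_one_add, h1, mul_zero]
      simp [G, g, hu, h1, h2]
    · have h2 : s + s * u ≠ 0 := by rw [← mul_one_add]; exact mul_ne_zero hs h1
      simp only [G, g, hu, mul_eq_zero, hs, h0, h1, h2, or_self, if_false]
      have h3 : s * u + (s + s * u) = s := by
        rw [add_left_comm, CharTwo.add_self_eq_zero, add_zero]
      have h4 : (s * u)⁻¹ + (s + s * u)⁻¹ = s⁻¹ * (u * (1 + u))⁻¹ := by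
        have h5 : u + (1 + u) = 1 := by
          rw [add_left_comm, CharTwo.add_self_eq_zero, add_zero]
        rw [← mul_one_add]
        field_simp
        linear_combination h5
      rw [h3, h4]
  rw [hsquare, ← Finset.add_sum_erase _ _ (Finset.mem_univ (0 : F)), hzero,
    Finset.sum_congr rfl fun s hs => hne s (Finset.ne_of_mem_erase hs)]
  have hu : ∑ s ∈ Finset.univ.erase (0 : F), ∑ t : F, g s t * (1 + ψ t)
      = ∑ s : Fˣ, ∑ t : Fˣ, ψ (s + a * ((s : F)⁻¹ * (t : F)⁻¹)) * (1 + ψ t) := by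
    rw [sum_units_eq_sum_ite fun s => ∑ t : Fˣ, ψ (s + a * (s⁻¹ * (t : F)⁻¹)) * (1 + ψ t),
      ← Finset.add_sum_erase (Finset.univ : Finset F) _ (Finset.mem_univ (0 : F)), if_pos rfl,
      zero_add]
    refine Finset.sum_congr rfl fun s hs => ?_
    rw [if_neg (Finset.ne_of_mem_erase hs),
      sum_units_eq_sum_ite fun t => ψ (s + a * (s⁻¹ * t⁻¹)) * (1 + ψ t)]
    refine Finset.sum_congr rfl fun t _ => ?_
    by_cases ht : t = 0 <;> simp [g, ht]
  have h1 : ∑ s : Fˣ, ∑ t : Fˣ, ψ (s + a * ((s : F)⁻¹ * (t : F)⁻¹)) = 1 := by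
    have h : ∀ s : Fˣ, ∑ t : Fˣ, ψ (s + a * ((s : F)⁻¹ * (t : F)⁻¹)) = -ψ (s * 1) := by
      intro s
      have hb : a * (s : F)⁻¹ ≠ 0 := mul_ne_zero ha (inv_ne_zero s.ne_zero)
      have h := Equiv.sum_comp (Equiv.inv Fˣ) fun t : Fˣ => ψ (t * (a * (s : F)⁻¹))
      rw [sum_units_addChar hψ hb] at h
      rw [mul_one, ← mul_neg_one (ψ _), ← h, Finset.mul_sum]
      refine Finset.sum_congr rfl fun t _ => ?_
      rw [← AddChar.map_add_eq_mul]
      congr 2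
      simp
      ring
    rw [Finset.sum_congr rfl fun s _ => h s, Finset.sum_neg_distrib,
      sum_units_addChar hψ one_ne_zero, neg_neg]
  have h2 : ∑ s : Fˣ, ∑ t : Fˣ, ψ (s + a * ((s : F)⁻¹ * (t : F)⁻¹)) * ψ t
      = kloostermanSum 2 ψ a := by
    rw [kloostermanSum_two]
    refine Finset.sum_congr rfl fun s _ => Finset.sum_congr rfl fun t _ => ?_
    rw [← AddChar.map_add_eq_mul]
    congr 1
    ring
  rw [hu]
  simp only [mul_add, mul_one, Finset.sum_add_distrib]
  rw [h1, h2]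
  ring

/-- Invariance of `ψ` under squaring replaces the pair of parameters `(a, a)` by `(1, a)`,
through the substitution `x = a⁻¹ y²`. -/
theorem sum_units_mul_add_mul_inv (hsq : ∀ x, ψ (x ^ 2) = ψ x) [CharP F 2] {a : F} (ha : a ≠ 0) :
    ∑ x : Fˣ, ψ (a * (x + (x : F)⁻¹)) = kloostermanSum 1 ψ a := by
  have hinj : Function.Injective fun y : Fˣ => (Units.mk0 a ha)⁻¹ * y ^ 2 := by
    intro y z hyz
    have h : (y : F) ^ 2 = (z : F) ^ 2 := by
      rw [← Units.val_pow_eq_pow_val, ← Units.val_pow_eq_pow_val, mul_left_cancel hyz]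
    exact Units.ext (frobenius_inj F 2 h)
  rw [kloostermanSum_one]
  refine (Fintype.sum_bijective _ (Finite.injective_iff_bijective.mp hinj) _ _ fun y => ?_).symm
  have hy : (y : F) ≠ 0 := y.ne_zero
  rw [← hsq]
  congr 1
  simp only [Units.val_mul, Units.val_inv_eq_inv_val, Units.val_mk0, Units.val_pow_eq_pow_val]
  rw [CharTwo.add_sq]
  field_simp

theorem sum_GL_eq_sum_ite {n : Type*} [Fintype n] [DecidableEq n]
    (f : Matrix n n F → Matrix n n F → ℂ) :
    ∑ A : GL n F, f A (A⁻¹ : GL n F) = ∑ M : Matrix n n F, if M.det = 0 then 0 else f M M⁻¹ := by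
  have h : ∑ M : Matrix n n F, (if M.det = 0 then 0 else f M M⁻¹)
      = ∑ M ∈ Finset.univ.filter (fun M : Matrix n n F => M.det ≠ 0), f M M⁻¹ := by
    rw [Finset.sum_filter]
    exact Finset.sum_congr rfl fun M _ => by by_cases hM : M.det = 0 <;> simp [hM]
  rw [h]
  refine Finset.sum_bij (fun A _ => (A : Matrix n n F)) ?_ (by simp [Units.val_inj]) ?_
    (by simp [Matrix.coe_units_inv])
  · intro A _
    simpa using ((Matrix.isUnit_iff_isUnit_det _).mp A.isUnit).ne_zero
  · intro M hM
    have hM' : M.det ≠ 0 := by simpa using hM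
    exact ⟨GeneralLinearGroup.mkOfDetNeZero M hM', by simp, rfl⟩

theorem sum_GL_one [CharP F 2] (hsq : ∀ x, ψ (x ^ 2) = ψ x) {a : F} (ha : a ≠ 0) :
    ∑ C : GL (Fin 1) F, ψ (a * ((C : Matrix (Fin 1) (Fin 1) F).trace +
      ((C⁻¹ : GL (Fin 1) F) : Matrix (Fin 1) (Fin 1) F).trace)) = kloostermanSum 1 ψ a := by
  rw [← sum_units_mul_add_mul_inv hsq ha, sum_units_eq_sum_ite fun x => ψ (a * (x + x⁻¹)),
    sum_GL_eq_sum_ite fun M N => ψ (a * (M.trace + N.trace))]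
  let e : F ≃ Matrix (Fin 1) (Fin 1) F :=
    ⟨fun x => !![x], fun M => M 0 0, fun x => rfl,
      fun M => by ext i j; fin_cases i; fin_cases j; rfl⟩
  rw [← e.sum_comp]
  refine Finset.sum_congr rfl fun x _ => ?_
  have hex : e x = !![x] := rfl
  simp [hex]

theorem sum_comp_mul (h : F → ℂ) :
    ∑ y : F, ∑ z : F, h (y * z) = (Fintype.card F - 1) * ∑ e : F, h e + Fintype.card F * h 0 := by
  rw [← Finset.add_sum_erase _ _ (Finset.mem_univ (0 : F))]
  have h1 : ∀ y ∈ Finset.univ.erase (0 : F), ∑ z : F, h (y * z) = ∑ e : F, h e := fun y hy =>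
    Equiv.sum_comp (Equiv.mulLeft₀ y (Finset.ne_of_mem_erase hy)) h
  rw [Finset.sum_congr rfl h1, Finset.sum_const, Finset.card_erase_of_mem (Finset.mem_univ _),
    Finset.card_univ, nsmul_eq_mul, Nat.cast_sub Fintype.card_pos]
  simp
  ring

/-- Grouping the matrices by their diagonal `(x, w)`, the determinant `x w - y z` takes every
value `q - 1` times, and the value `x w` another `q` times. The first contribution is a complete
sum, which only sees determinant one; the second is the square of the sum over `GL₁`. -/
theorem sum_GL_two [CharP F 2] (hψ : ψ.IsPrimitive) (hsq : ∀ x, ψ (x ^ 2) = ψ x)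
    {a : F} (ha : a ≠ 0) :
    ∑ C : GL (Fin 2) F, ψ (a * ((C : Matrix (Fin 2) (Fin 2) F).trace +
      ((C⁻¹ : GL (Fin 2) F) : Matrix (Fin 2) (Fin 2) F).trace))
      = Fintype.card F * (kloostermanSum 1 ψ a ^ 2 + (Fintype.card F : ℂ) ^ 2 - Fintype.card F) := by
  let g : F → F → ℂ := fun t d => if d = 0 then 0 else ψ (t * (a * (1 + d⁻¹)))
  let e : F × F × F × F ≃ Matrix (Fin 2) (Fin 2) F :=
    ⟨fun p => !![p.1, p.2.2.1; p.2.2.2, p.2.1], fun M => (M 0 0, M 1 1, M 0 1, M 1 0),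
      fun p => rfl, fun M => by ext i j; fin_cases i <;> fin_cases j <;> rfl⟩
  have h1 : ∑ C : GL (Fin 2) F, ψ (a * ((C : Matrix (Fin 2) (Fin 2) F).trace +
      ((C⁻¹ : GL (Fin 2) F) : Matrix (Fin 2) (Fin 2) F).trace))
      = ∑ x : F, ∑ w : F, ∑ y : F, ∑ z : F, g (x + w) (x * w - y * z) := by
    rw [sum_GL_eq_sum_ite fun M N => ψ (a * (M.trace + N.trace)), ← e.sum_comp,
      Fintype.sum_prod_type]
    simp only [Fintype.sum_prod_type]
    refine Finset.sum_congr rfl fun x _ => Finset.sum_congr rfl fun w _ =>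
      Finset.sum_congr rfl fun y _ => Finset.sum_congr rfl fun z _ => ?_
    have hex : e (x, w, y, z) = !![x, y; z, w] := rfl
    have hdet : (e (x, w, y, z)).det = x * w - y * z := by simp [hex, Matrix.det_fin_two]
    have htr : (e (x, w, y, z)).trace = x + w := by simp [hex, Matrix.trace_fin_two]
    have hinv : (e (x, w, y, z))⁻¹.trace = (x * w - y * z)⁻¹ * (x + w) := by
      rw [Matrix.inv_def, hdet, Matrix.trace_smul, Matrix.adjugate_fin_two, Ring.inverse_eq_inv']
      simp [hex, Matrix.trace_fin_two, add_comm]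
    rw [hdet, htr, hinv]
    simp only [g]
    congr 2
    ring
  have h2 : ∀ x w : F, ∑ y : F, ∑ z : F, g (x + w) (x * w - y * z)
      = (Fintype.card F - 1) * ∑ d : F, g (x + w) d + Fintype.card F * g (x + w) (x * w) := by
    intro x w
    rw [sum_comp_mul fun v => g (x + w) (x * w - v), sub_zero]
    congr 2
    exact Equiv.sum_comp (Equiv.subLeft (x * w)) (g (x + w))
  have h3 : ∑ x : F, ∑ w : F, ∑ d : F, g (x + w) d = (Fintype.card F : ℂ) ^ 2 := by
    have h4 : ∀ x : F, ∑ w : F, ∑ d : F, g (x + w) d = ∑ w : F, ∑ d : F, g w d := fun x =>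
      Equiv.sum_comp (Equiv.addLeft x) fun t => ∑ d : F, g t d
    have h5 : ∀ d : F, ∑ t : F, g t d = if d = 1 then (Fintype.card F : ℂ) else 0 := by
      intro d
      by_cases hd : d = 0
      · simp [g, hd]
      have h6 : a * (1 + d⁻¹) = 0 ↔ d = 1 := by
        rw [← CharTwo.sub_eq_add, mul_eq_zero, sub_eq_zero, eq_comm (a := (1 : F)), inv_eq_one]
        simp [ha]
      simp only [g, hd, if_false]
      rw [AddChar.sum_mulShift _ hψ]
      simp [h6]
    rw [Finset.sum_congr rfl fun x _ => h4 x, Finset.sum_const, Finset.sum_comm,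
      Finset.sum_congr rfl fun d _ => h5 d]
    simp [sq]
  have h4 : ∑ x : F, ∑ w : F, g (x + w) (x * w) = kloostermanSum 1 ψ a ^ 2 := by
    rw [← sum_units_mul_add_mul_inv hsq ha, sum_units_eq_sum_ite fun x => ψ (a * (x + x⁻¹)), sq,
      Finset.sum_mul_sum]
    refine Finset.sum_congr rfl fun x _ => Finset.sum_congr rfl fun w _ => ?_
    by_cases hx : x = 0
    · simp [g, hx]
    by_cases hw : w = 0
    · simp [g, hw]
    simp only [g, mul_eq_zero, hx, hw, or_self, if_false]
    rw [← AddChar.map_add_eq_mul]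
    congr 1
    field_simp
    ring
  rw [h1]
  simp only [h2, Finset.sum_add_distrib, ← Finset.mul_sum]
  rw [h3, h4]
  ring

end CharacterSums

/-! ### Invertible symmetric matrices -/

section SymmetricMatrices

variable {F ι κ : Type*}

/-- The type of symmetric matrices. -/
abbrev SymmMatrix (ι F : Type*) : Type _ := {M : Matrix ι ι F // M.IsSymm}

/-- The matrix `[x, ᵗv; v, M]`. -/
def bordered (x : F) (v : κ → F) (M : Matrix κ κ F) : Matrix (Unit ⊕ κ) (Unit ⊕ κ) F :=
  fromBlocks (of fun _ _ => x) (of fun _ j => v j) (of fun i _ => v i) M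

theorem bordered_isSymm {x : F} {v : κ → F} {M : Matrix κ κ F} (hM : M.IsSymm) :
    (bordered x v M).IsSymm := by
  refine Matrix.IsSymm.fromBlocks ?_ rfl hM
  rfl

/-- A symmetric matrix is determined by its first diagonal entry, the rest of its first row, and
the complementary symmetric block. -/
def symmMatrixEquiv : F × (κ → F) × SymmMatrix κ F ≃ SymmMatrix (Unit ⊕ κ) F where
  toFun p := ⟨bordered p.1 p.2.1 p.2.2.1, bordered_isSymm p.2.2.2⟩
  invFun M := (M.1 (Sum.inl ()) (Sum.inl ()), fun i => M.1 (Sum.inr i) (Sum.inl ()),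
    ⟨M.1.toBlocks₂₂, by ext i j; exact M.2.apply _ _⟩)
  left_inv p := rfl
  right_inv M := by
    ext i j
    rcases i with i | i <;> rcases j with j | j
    · rfl
    · exact M.2.apply _ _
    · rfl
    · rfl

variable [Field F] [Fintype F] [DecidableEq F]
variable [Fintype ι] [DecidableEq ι] [Fintype κ] [DecidableEq κ]

/-- The number of invertible symmetric matrices, as a sum of indicators. -/
def symmUnitCount (ι F : Type*) [Field F] [Fintype F] [DecidableEq F] [Fintype ι]
    [DecidableEq ι] : ℕ :=
  ∑ M : SymmMatrix ι F, if M.1.det = 0 then 0 else 1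

theorem symmUnitCount_congr (e : ι ≃ κ) : symmUnitCount ι F = symmUnitCount κ F := by
  let E : SymmMatrix ι F ≃ SymmMatrix κ F :=
    (Matrix.reindex e e).subtypeEquiv fun M => by
      constructor
      · intro h; exact h.submatrix _
      · intro h; simpa using h.submatrix e
  rw [symmUnitCount, symmUnitCount, ← E.sum_comp]
  refine Finset.sum_congr rfl fun M _ => ?_
  have h : (E M).1.det = M.1.det := Matrix.det_reindex_self e M.1
  rw [h]

theorem symmUnitCount_of_isEmpty [IsEmpty ι] : symmUnitCount ι F = 1 := by
  have : Unique (SymmMatrix ι F) :=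
    ⟨⟨⟨0, Subsingleton.elim _ _⟩⟩, fun _ => Subtype.ext (Subsingleton.elim _ _)⟩
  rw [symmUnitCount, Fintype.sum_unique]
  simp

/-- The number of symmetric `M` for which the bordered matrix `[x, ᵗv; v, M]` is invertible. -/
def borderCount (x : F) (v : κ → F) : ℕ :=
  ∑ M : SymmMatrix κ F, if (bordered x v M.1).det = 0 then 0 else 1

theorem symmUnitCount_unit_sum :
    symmUnitCount (Unit ⊕ κ) F = ∑ x : F, ∑ v : κ → F, borderCount x v := by
  rw [symmUnitCount, ← symmMatrixEquiv.sum_comp, Fintype.sum_prod_type]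
  refine Finset.sum_congr rfl fun x _ => ?_
  rw [Fintype.sum_prod_type]
  rfl

/-- For `x ≠ 0` the bordered matrix is invertible exactly when the Schur complement
`M - x⁻¹ v ᵗv` is, and this is a translate of `M`. -/
theorem borderCount_of_ne_zero {x : F} (hx : x ≠ 0) (v : κ → F) :
    borderCount x v = symmUnitCount κ F := by
  let R : Matrix κ κ F := of fun i j => v i * x⁻¹ * v j
  have hR : R.IsSymm := by ext i j; simp only [R, transpose_apply, of_apply]; ring
  let E : SymmMatrix κ F ≃ SymmMatrix κ F :=
    (Equiv.subRight R).subtypeEquiv fun M => by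
      constructor
      · intro h; exact h.sub hR
      · intro h; simpa using h.add hR
  rw [borderCount, symmUnitCount, ← E.sum_comp fun M => if M.1.det = 0 then 0 else 1]
  refine Finset.sum_congr rfl fun M _ => ?_
  let A : Matrix Unit Unit F := of fun _ _ => x
  have : Invertible A := ⟨of fun _ _ => x⁻¹, by ext i j; simp [A, Matrix.mul_apply, hx],
    by ext i j; simp [A, Matrix.mul_apply, hx]⟩
  have hinv : ⅟A = of fun _ _ => x⁻¹ := by
    refine invOf_eq_right_inv ?_
    ext i j; simp [A, Matrix.mul_apply, hx]
  have h : (bordered x v M.1).det = x * (E M).1.det := by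
    change (fromBlocks A _ _ _).det = _
    rw [det_fromBlocks₁₁, hinv]
    congr 1
    · simp [A]
    · congr 1
      ext i j
      simp [E, R, Matrix.mul_apply]
  simp [h, hx]

theorem borderCount_zero_zero : borderCount (0 : F) (0 : κ → F) = 0 := by
  refine Finset.sum_eq_zero fun M _ => if_pos ?_
  change (fromBlocks (of fun _ _ => (0 : F)) 0 _ M.1).det = 0
  rw [det_fromBlocks_zero₁₂]
  simp

/-- Congruence by an invertible matrix with `i`-th column `v` carries the border `eᵢ` to `v`. -/
theorem borderCount_zero_eq_single {v : κ → F} {i : κ} (hi : v i ≠ 0) :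
    borderCount 0 v = borderCount 0 (Pi.single i (1 : F)) := by
  let g : Matrix κ κ F := (1 : Matrix κ κ F).updateCol i v
  have hg : g.det = v i := by
    rw [← Matrix.cramer_apply, Matrix.cramer_one]; rfl
  have hgu : IsUnit g.det := by rw [hg]; exact hi.isUnit
  have hcol : ∀ k, g k i = v k := fun k => by simp [g]
  let E : SymmMatrix κ F ≃ SymmMatrix κ F :=
    { toFun := fun M => ⟨g * M.1 * gᵀ, by
        have := M.2
        simp [Matrix.IsSymm, Matrix.transpose_mul, this.eq, Matrix.mul_assoc]⟩
      invFun := fun M => ⟨g⁻¹ * M.1 * g⁻¹ᵀ, by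
        have := M.2
        simp only [Matrix.IsSymm, Matrix.transpose_mul, this.eq, Matrix.mul_assoc,
          Matrix.transpose_transpose]⟩
      left_inv := fun M => Subtype.ext (by
        change g⁻¹ * (g * M.1 * gᵀ) * g⁻¹ᵀ = M.1
        rw [Matrix.mul_assoc g, Matrix.nonsing_inv_mul_cancel_left _ _ hgu, Matrix.mul_assoc,
          ← Matrix.transpose_mul, Matrix.nonsing_inv_mul _ hgu]
        simp)
      right_inv := fun M => Subtype.ext (by
        change g * (g⁻¹ * M.1 * g⁻¹ᵀ) * gᵀ = M.1
        rw [Matrix.mul_assoc g⁻¹, Matrix.mul_nonsing_inv_cancel_left _ _ hgu, Matrix.mul_assoc,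
          ← Matrix.transpose_mul, Matrix.mul_nonsing_inv _ hgu]
        simp) }
  rw [borderCount, borderCount, ← E.sum_comp]
  refine Finset.sum_congr rfl fun M _ => ?_
  have h : bordered 0 v (E M).1 = fromBlocks (1 : Matrix Unit Unit F) 0 0 g *
      bordered 0 (Pi.single i 1) M.1 * (fromBlocks (1 : Matrix Unit Unit F) 0 0 g)ᵀ := by
    rw [bordered, bordered, fromBlocks_transpose, fromBlocks_multiply, fromBlocks_multiply]
    simp only [Matrix.one_mul, Matrix.zero_mul, add_zero, zero_add, Matrix.transpose_one,
      Matrix.transpose_zero, Matrix.mul_one, Matrix.mul_zero]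
    congr 1
    · ext k l
      simp [Matrix.mul_apply, Pi.single_apply, hcol]
    · ext k l
      simp [Matrix.mul_apply, Pi.single_apply, hcol]
  rw [h, det_mul, det_mul, det_transpose, det_fromBlocks_zero₁₂]
  simp [hg, hi]

theorem borderCount_zero_congr {v w : κ → F} (hv : v ≠ 0) (hw : w ≠ 0) :
    borderCount 0 v = borderCount 0 w := by
  obtain ⟨i, hi⟩ := Function.ne_iff.mp hv
  obtain ⟨j, hj⟩ := Function.ne_iff.mp hw
  rw [borderCount_zero_eq_single hi, borderCount_zero_eq_single hj]
  by_cases hij : i = j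
  · rw [hij]
  -- a vector with nonzero entries in both places links the two standard basis vectors
  · let u : κ → F := Pi.single i 1 + Pi.single j 1
    have hui : u i ≠ 0 := by simp [u, hij]
    have huj : u j ≠ 0 := by simp [u, Ne.symm hij]
    rw [← borderCount_zero_eq_single hui, borderCount_zero_eq_single huj]

/-- With border `(0, e₁)`, only the block of `M` complementary to `e₁` matters: exchanging the
first two rows makes the matrix block triangular. -/
theorem borderCount_zero_single :
    borderCount (0 : F) (Pi.single (Sum.inl ()) 1 : Unit ⊕ ι → F)
      = Fintype.card F * Fintype.card F ^ Fintype.card ι * symmUnitCount ι F := by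
  have hdet : ∀ (y : F) (u : ι → F) (L : Matrix ι ι F),
      (bordered 0 (Pi.single (Sum.inl ()) 1) (bordered y u L)).det = 0 ↔ L.det = 0 := by
    intro y u L
    let τ : Equiv.Perm (Unit ⊕ (Unit ⊕ ι)) := Equiv.swap (Sum.inl ()) (Sum.inr (Sum.inl ()))
    have h : (bordered 0 (Pi.single (Sum.inl ()) 1) (bordered y u L)).submatrix τ id
        = fromBlocks (1 : Matrix Unit Unit F) (of fun _ j => Sum.elim (fun _ => y) u j) 0
          (fromBlocks (1 : Matrix Unit Unit F) 0 (of fun i _ => u i) L) := by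
      ext i j
      rcases i with i | i | i
      · have hτ : τ (Sum.inl i) = Sum.inr (Sum.inl ()) := Equiv.swap_apply_left _ _
        rcases j with j | j | j <;> simp [hτ, bordered]
      · have hτ : τ (Sum.inr (Sum.inl i)) = Sum.inl () := Equiv.swap_apply_right _ _
        rcases j with j | j | j <;> simp [hτ, bordered]
      · have hτ : τ (Sum.inr (Sum.inr i)) = Sum.inr (Sum.inr i) :=
          Equiv.swap_apply_of_ne_of_ne (by simp) (by simp)
        rcases j with j | j | j <;> simp [hτ, bordered]
    have h2 := congrArg Matrix.det h
    rw [Matrix.det_permute, det_fromBlocks_zero₂₁, det_fromBlocks_zero₁₂, det_one, one_mul,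
      one_mul] at h2
    rw [← h2]
    rcases Int.units_eq_one_or (Equiv.Perm.sign τ) with h3 | h3 <;> simp [h3]
  rw [borderCount, ← symmMatrixEquiv.sum_comp, Fintype.sum_prod_type]
  have h : ∀ (y : F) (u : ι → F) (L : SymmMatrix ι F),
      (if (bordered 0 (Pi.single (Sum.inl ()) 1) (symmMatrixEquiv (y, u, L)).1).det = 0
        then 0 else 1) = if L.1.det = 0 then 0 else 1 :=
    fun y u L => if_congr (hdet y u L.1) rfl rfl
  rw [Finset.sum_congr rfl fun y _ => Fintype.sum_prod_type _,
    Finset.sum_congr rfl fun y _ => Finset.sum_congr rfl fun u _ =>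
      Finset.sum_congr rfl fun L _ => h y u L]
  simp [symmUnitCount, mul_assoc]

/-- Splitting off the corner entry `x`: `x ≠ 0` leaves a Schur complement, `x = 0` needs a nonzero
border `v`, and all such borders contribute alike. -/
theorem symmUnitCount_unit_sum_unit_sum :
    (symmUnitCount (Unit ⊕ (Unit ⊕ ι)) F : ℂ)
      = (Fintype.card F - 1) * (Fintype.card F : ℂ) ^ (Fintype.card ι + 1)
          * symmUnitCount (Unit ⊕ ι) F
        + ((Fintype.card F : ℂ) ^ (Fintype.card ι + 1) - 1)
          * (Fintype.card F : ℂ) ^ (Fintype.card ι + 1) * symmUnitCount ι F := by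
  have hcard : Fintype.card (Unit ⊕ ι → F) = Fintype.card F ^ (Fintype.card ι + 1) := by
    simp [add_comm]
  rw [symmUnitCount_unit_sum, ← Finset.add_sum_erase _ _ (Finset.mem_univ (0 : F)),
    ← Finset.add_sum_erase _ _ (Finset.mem_univ (0 : Unit ⊕ ι → F)), borderCount_zero_zero,
    zero_add]
  have h1 : ∀ v ∈ Finset.univ.erase (0 : Unit ⊕ ι → F), borderCount (0 : F) v
      = Fintype.card F * Fintype.card F ^ Fintype.card ι * symmUnitCount ι F := by
    intro v hv
    rw [← borderCount_zero_single]
    exact borderCount_zero_congr (Finset.ne_of_mem_erase hv) (by simp)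
  have h2 : ∀ x ∈ Finset.univ.erase (0 : F), ∑ v : Unit ⊕ ι → F, borderCount x v
      = Fintype.card F ^ (Fintype.card ι + 1) * symmUnitCount (Unit ⊕ ι) F := by
    intro x hx
    rw [Finset.sum_congr rfl fun v _ => borderCount_of_ne_zero (Finset.ne_of_mem_erase hx) v,
      Finset.sum_const, Finset.card_univ, hcard, smul_eq_mul]
  rw [Finset.sum_congr rfl h1, Finset.sum_congr rfl h2, Finset.sum_const, Finset.sum_const,
    Finset.card_erase_of_mem (Finset.mem_univ _), Finset.card_erase_of_mem (Finset.mem_univ _),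
    Finset.card_univ, Finset.card_univ, hcard, smul_eq_mul, smul_eq_mul]
  have hq : 0 < Fintype.card F := Fintype.card_pos
  push_cast [Nat.cast_sub hq, Nat.cast_sub (pow_pos hq (Fintype.card ι + 1) : 1 ≤ _)]
  ring

theorem symmUnitCount_fin_add_two (s : ℕ) :
    (symmUnitCount (Fin (s + 2)) F : ℂ)
      = (Fintype.card F - 1) * (Fintype.card F : ℂ) ^ (s + 1) * symmUnitCount (Fin (s + 1)) F
        + ((Fintype.card F : ℂ) ^ (s + 1) - 1)
          * (Fintype.card F : ℂ) ^ (s + 1) * symmUnitCount (Fin s) F := by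
  have e1 : Fin (s + 1) ≃ Unit ⊕ Fin s := Fintype.equivOfCardEq (by simp [add_comm])
  have e2 : Fin (s + 2) ≃ Unit ⊕ (Unit ⊕ Fin s) :=
    Fintype.equivOfCardEq (by simp; omega)
  rw [symmUnitCount_congr e1, symmUnitCount_congr e2, symmUnitCount_unit_sum_unit_sum,
    Fintype.card_fin]

theorem symmUnitCount_fin_one : (symmUnitCount (Fin 1) F : ℂ) = Fintype.card F - 1 := by
  have e : Fin 1 ≃ Unit ⊕ Fin 0 := Fintype.equivOfCardEq (by simp)
  rw [symmUnitCount_congr e, symmUnitCount_unit_sum,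
    ← Finset.add_sum_erase _ _ (Finset.mem_univ (0 : F)), Fintype.sum_unique,
    Subsingleton.elim default (0 : Fin 0 → F), borderCount_zero_zero, zero_add]
  have h : ∀ x ∈ Finset.univ.erase (0 : F), ∑ v : Fin 0 → F, borderCount x v = 1 := by
    intro x hx
    rw [Fintype.sum_unique, borderCount_of_ne_zero (Finset.ne_of_mem_erase hx),
      symmUnitCount_of_isEmpty]
  rw [Finset.sum_congr rfl h]
  simp [Nat.cast_sub (Fintype.card_pos (α := F) : 1 ≤ _), Finset.card_erase_of_mem,
    Finset.card_univ]

/-- The closed form of the number of invertible symmetric matrices, in even and odd size. -/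
theorem symmUnitCount_fin_even_odd (k : ℕ) :
    (symmUnitCount (Fin (2 * k)) F : ℂ) = (Fintype.card F : ℂ) ^ (k * (k + 1)) *
        ∏ j ∈ Finset.Icc 1 k, ((Fintype.card F : ℂ) ^ (2 * j - 1) - 1) ∧
    (symmUnitCount (Fin (2 * k + 1)) F : ℂ) = (Fintype.card F : ℂ) ^ (k * (k + 1)) *
        ∏ j ∈ Finset.Icc 1 (k + 1), ((Fintype.card F : ℂ) ^ (2 * j - 1) - 1) := by
  induction k with
  | zero =>
    refine ⟨?_, ?_⟩
    · rw [mul_zero, symmUnitCount_of_isEmpty]; simp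
    · rw [symmUnitCount_fin_one]; simp
  | succ k ih =>
    have h1 : (symmUnitCount (Fin (2 * (k + 1))) F : ℂ) =
        (Fintype.card F : ℂ) ^ ((k + 1) * (k + 1 + 1)) *
        ∏ j ∈ Finset.Icc 1 (k + 1), ((Fintype.card F : ℂ) ^ (2 * j - 1) - 1) := by
      rw [show 2 * (k + 1) = 2 * k + 2 by ring, symmUnitCount_fin_add_two, ih.1, ih.2,
        Finset.prod_Icc_succ_top (by omega), show 2 * (k + 1) - 1 = 2 * k + 1 by omega]
      ring
    refine ⟨h1, ?_⟩
    rw [show 2 * (k + 1) + 1 = (2 * k + 1) + 2 by ring, symmUnitCount_fin_add_two,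
      show 2 * k + 1 + 1 = 2 * (k + 1) by ring, h1, ih.2,
      Finset.prod_Icc_succ_top (b := k + 1) (by omega),
      show 2 * (k + 1 + 1) - 1 = 2 * k + 3 by omega]
    ring

end SymmetricMatrices

/-! ### Sums of class functions over a double coset -/

section DoubleCosetSums

/-- Every element of `P s P` is `x s y` with `x, y ∈ P` in as many ways as there are `h ∈ P` with
`s⁻¹ h s ∈ P`; for a class function, the sum over all pairs `(x, y)` collapses to one over `P`. -/
theorem card_mul_sum_doubleCoset {G : Type*} [Group G] [DecidableEq G] (P : Subgroup G)
    [Fintype P] (s : G) (f : G → ℂ) (hf : ∀ x y, f (x * y) = f (y * x)) (D : Finset G)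
    (hD : ∀ w, w ∈ D ↔ w ∈ DoubleCoset.doubleCoset s (P : Set G) P) :
    (Nat.card {h : P // s⁻¹ * (h : G) * s ∈ P} : ℂ) * ∑ w ∈ D, f w
      = Fintype.card P * ∑ p : P, f (p * s) := by
  have hfiber : ∀ w ∈ D, ((Finset.univ : Finset (P × P)).filter
      fun z => (z.1 : G) * s * z.2 = w).card = Nat.card {h : P // s⁻¹ * (h : G) * s ∈ P} := by
    intro w hw
    obtain ⟨x, hx, y, hy, rfl⟩ := DoubleCoset.mem_doubleCoset.mp ((hD w).mp hw)
    rw [← Fintype.card_subtype, ← Nat.card_eq_fintype_card]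
    refine Nat.card_congr
      { toFun := fun z => ⟨⟨x⁻¹ * z.1.1, P.mul_mem (P.inv_mem hx) z.1.1.2⟩, ?_⟩
        invFun := fun h => ⟨(⟨x * h.1, P.mul_mem hx h.1.2⟩,
          ⟨(s⁻¹ * h.1 * s)⁻¹ * y, P.mul_mem (P.inv_mem h.2) hy⟩), ?_⟩
        left_inv := ?_
        right_inv := ?_ }
    · have h : s⁻¹ * (x⁻¹ * (z.1.1 : G)) * s = y * (z.1.2 : G)⁻¹ := by
        rw [eq_mul_inv_iff_mul_eq, ← mul_right_inj (x * s)]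
        calc x * s * (s⁻¹ * (x⁻¹ * (z.1.1 : G)) * s * z.1.2) = z.1.1 * s * z.1.2 := by group
          _ = x * s * y := z.2
      change s⁻¹ * (x⁻¹ * (z.1.1 : G)) * s ∈ P
      rw [h]
      exact P.mul_mem hy (P.inv_mem z.1.2.2)
    · change x * (h.1 : G) * s * ((s⁻¹ * h.1 * s)⁻¹ * y) = x * s * y
      group
    · rintro ⟨⟨z₁, z₂⟩, hz⟩
      refine Subtype.ext (Prod.ext (Subtype.ext ?_) (Subtype.ext ?_))
      · change x * (x⁻¹ * (z₁ : G)) = z₁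
        group
      · change (s⁻¹ * (x⁻¹ * (z₁ : G)) * s)⁻¹ * y = z₂
        rw [inv_mul_eq_iff_eq_mul, ← mul_right_inj (x * s)]
        simp only at hz
        rw [← hz]
        group
    · rintro ⟨h, hh⟩
      refine Subtype.ext (Subtype.ext ?_)
      change x⁻¹ * (x * (h : G)) = h
      group
  have hpairs : ∑ z : P × P, f (z.1 * s * z.2) = Fintype.card P * ∑ p : P, f (p * s) := by
    rw [Fintype.sum_prod_type_right]
    have h : ∀ y : P, ∑ x : P, f (x * s * y) = ∑ p : P, f (p * s) := by
      intro y
      rw [← Equiv.sum_comp (Equiv.mulLeft y) fun p : P => f (p * s)]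
      refine Finset.sum_congr rfl fun x _ => ?_
      rw [hf, ← mul_assoc]
      rfl
    rw [Finset.sum_congr rfl fun y _ => h y]
    simp
  rw [← hpairs, ← Finset.sum_fiberwise_of_maps_to (t := D)
      (g := fun z : P × P => (z.1 : G) * s * z.2)
      fun z _ => (hD _).mpr (DoubleCoset.mem_doubleCoset.mpr ⟨_, z.1.2, _, z.2.2, rfl⟩),
    Finset.mul_sum]
  refine Finset.sum_congr rfl fun w hw => ?_
  rw [Finset.sum_congr rfl fun z hz => congrArg f (Finset.mem_filter.mp hz).2, Finset.sum_const,
    hfiber w hw, nsmul_eq_mul]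

end DoubleCosetSums

/-! ### Alternating matrices -/

section AlternatingMatrices

variable {F : Type*} [Field F] {ι m k : Type*}

/-- The additive group of alternating matrices, indexed by an arbitrary type. -/
def altMatrix (ι F : Type*) [Field F] : AddSubgroup (Matrix ι ι F) where
  carrier := {B | (∀ i, B i i = 0) ∧ ∀ i j, B i j = -B j i}
  zero_mem' := ⟨fun _ => rfl, fun _ _ => by simp⟩
  add_mem' {B C} hB hC := ⟨fun i => by simp [hB.1 i, hC.1 i], fun i j => by
    rw [Matrix.add_apply, Matrix.add_apply, hB.2 i j, hC.2 i j]; ring⟩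
  neg_mem' {B} hB := ⟨fun i => by simp [hB.1 i], fun i j => by
    rw [Matrix.neg_apply, Matrix.neg_apply, hB.2 i j]⟩

theorem sub_transpose_mem_altMatrix (N : Matrix ι ι F) : N - Nᵀ ∈ altMatrix ι F :=
  ⟨fun i => by simp, fun i j => by simp⟩

/-- In every characteristic, an alternating matrix is `N - ᵗN` with `N` its upper triangle. -/
theorem exists_sub_transpose {B : Matrix ι ι F} (hB : B ∈ altMatrix ι F) :
    ∃ N : Matrix ι ι F, B = N - Nᵀ := by
  classical
  let r : ι → ι → Prop := WellOrderingRel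
  refine ⟨of fun i j => if r i j then B i j else 0, ?_⟩
  ext i j
  rcases trichotomous_of r i j with h | h | h
  · have h' : ¬ r j i := asymm_of r h
    simp [h, h']
  · subst h; simp [hB.1 i]
  · have h' : ¬ r i j := asymm_of r h
    simp [h, h', hB.2 i j]

theorem conj_mem_altMatrix [Fintype ι] {κ : Type*} {B : Matrix ι ι F}
    (hB : B ∈ altMatrix ι F) (g : Matrix κ ι F) : g * B * gᵀ ∈ altMatrix κ F := by
  obtain ⟨N, rfl⟩ := exists_sub_transpose hB
  have h : g * (N - Nᵀ) * gᵀ = g * N * gᵀ - (g * N * gᵀ)ᵀ := by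
    simp [Matrix.mul_sub, Matrix.sub_mul, Matrix.mul_assoc]
  rw [h]
  exact sub_transpose_mem_altMatrix _

theorem fromBlocks_mem_altMatrix {P : Matrix m m F} {Q : Matrix m k F} {R : Matrix k m F}
    {S : Matrix k k F} : fromBlocks P Q R S ∈ altMatrix (m ⊕ k) F ↔
      P ∈ altMatrix m F ∧ S ∈ altMatrix k F ∧ R = -Qᵀ := by
  constructor
  · intro h
    refine ⟨⟨fun i => h.1 (Sum.inl i), fun i j => h.2 (Sum.inl i) (Sum.inl j)⟩,
      ⟨fun i => h.1 (Sum.inr i), fun i j => h.2 (Sum.inr i) (Sum.inr j)⟩, ?_⟩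
    ext i j
    exact h.2 (Sum.inr i) (Sum.inl j)
  · rintro ⟨hP, hS, rfl⟩
    refine ⟨?_, ?_⟩
    · rintro (i | i)
      · exact hP.1 i
      · exact hS.1 i
    · rintro (i | i) (j | j)
      · exact hP.2 i j
      · simp
      · simp
      · exact hS.2 i j

/-- An alternating matrix is given by its two diagonal blocks and its upper right block. -/
def altMatrixSumEquiv : altMatrix m F × Matrix m k F × altMatrix k F ≃ altMatrix (m ⊕ k) F where
  toFun p := ⟨fromBlocks p.1 p.2.1 (-p.2.1ᵀ) p.2.2,
    fromBlocks_mem_altMatrix.mpr ⟨p.1.2, p.2.2.2, rfl⟩⟩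
  invFun B := (⟨B.1.toBlocks₁₁, fun i => B.2.1 _, fun i j => B.2.2 _ _⟩, B.1.toBlocks₁₂,
    ⟨B.1.toBlocks₂₂, fun i => B.2.1 _, fun i j => B.2.2 _ _⟩)
  left_inv p := rfl
  right_inv B := by
    refine Subtype.ext ?_
    have h := B.2
    rw [← fromBlocks_toBlocks B.1, fromBlocks_mem_altMatrix] at h
    change fromBlocks _ _ _ _ = B.1
    conv_rhs => rw [← fromBlocks_toBlocks B.1, h.2.2]

/-- Renaming the index type of alternating matrices. -/
def altMatrixCongr {κ : Type*} (e : ι ≃ κ) : altMatrix ι F ≃ altMatrix κ F :=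
  (Matrix.reindex e e).subtypeEquiv fun B => by
    constructor
    · intro h; exact ⟨fun i => h.1 _, fun i j => h.2 _ _⟩
    · intro h
      refine ⟨fun i => ?_, fun i j => ?_⟩
      · simpa using h.1 (e i)
      · simpa using h.2 (e i) (e j)

variable [Fintype F]

omit [Field F] in
theorem natCard_matrix [Fintype m] [Fintype k] :
    Nat.card (Matrix m k F) = Fintype.card F ^ (Fintype.card m * Fintype.card k) := by
  classical
  rw [Nat.card_eq_fintype_card]
  change Fintype.card (m → k → F) = _
  rw [Fintype.card_fun, Fintype.card_fun, ← pow_mul, mul_comm]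

theorem natCard_altMatrix_sum [Fintype m] [Fintype k] :
    Nat.card (altMatrix (m ⊕ k) F) = Nat.card (altMatrix m F) *
      (Fintype.card F ^ (Fintype.card m * Fintype.card k) * Nat.card (altMatrix k F)) := by
  classical
  rw [← Nat.card_congr altMatrixSumEquiv, Nat.card_prod, Nat.card_prod, natCard_matrix]

theorem natCard_altMatrix_fin (n : ℕ) :
    Nat.card (altMatrix (Fin n) F) = Fintype.card F ^ n.choose 2 := by
  have hunit : Nat.card (altMatrix Unit F) = 1 := by
    have : Unique (altMatrix Unit F) :=
      ⟨⟨0⟩, fun B => Subtype.ext (by ext i j; exact B.2.1 i)⟩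
    exact Nat.card_unique
  induction n with
  | zero =>
    have : Unique (altMatrix (Fin 0) F) := ⟨⟨0⟩, fun B => Subtype.ext (Subsingleton.elim _ _)⟩
    simp
  | succ n ih =>
    have e : Fin (n + 1) ≃ Unit ⊕ Fin n := Fintype.equivOfCardEq (by simp [add_comm])
    rw [Nat.card_congr (altMatrixCongr e), natCard_altMatrix_sum, hunit, ih, ← pow_add]
    simp [Nat.choose_succ_succ n 1]

noncomputable instance [Fintype ι] : Fintype (altMatrix ι F) :=
  have : Finite (Matrix ι ι F) := inferInstanceAs (Finite (ι → ι → F))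
  Fintype.ofFinite _

/-- The alternating matrices are the orthogonal complement of the symmetric ones under the trace
form, so a character `B ↦ ψ (a tr (B M))` of their group is trivial exactly when `M` is
symmetric. -/
theorem sum_altMatrix_addChar [Fintype ι] [DecidableEq F] {ψ : AddChar F ℂ} (hψ : ψ.IsPrimitive)
    {a : F} (ha : a ≠ 0) (M : Matrix ι ι F) [Decidable M.IsSymm] :
    ∑ B : altMatrix ι F, ψ (a * (B.1 * M).trace)
      = if M.IsSymm then (Nat.card (altMatrix ι F) : ℂ) else 0 := by
  classical
  let χ : AddChar (altMatrix ι F) ℂ :=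
    { toFun := fun B => ψ (a * (B.1 * M).trace)
      map_zero_eq_one' := by simp
      map_add_eq_mul' := fun B C => by
        rw [← AddChar.map_add_eq_mul, AddSubgroup.coe_add, Matrix.add_mul, Matrix.trace_add,
          mul_add] }
  have hχ : χ = 0 ↔ M.IsSymm := by
    constructor
    · intro h
      by_contra hM
      obtain ⟨i, j, hij⟩ : ∃ i j, M j i ≠ M i j := by
        by_contra! h'
        exact hM (by ext i j; exact h' i j)
      have hd : a * (M j i - M i j) ≠ 0 := mul_ne_zero ha (sub_ne_zero.mpr hij)
      refine hψ hd ?_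
      ext c
      have h2 : χ ⟨Matrix.single i j c - (Matrix.single i j c)ᵀ,
          sub_transpose_mem_altMatrix _⟩ = 1 := by rw [h]; rfl
      change ψ (a * ((Matrix.single i j c - (Matrix.single i j c)ᵀ) * M).trace) = 1 at h2
      rw [Matrix.transpose_single, Matrix.sub_mul, Matrix.trace_sub, Matrix.trace_single_mul,
        Matrix.trace_single_mul] at h2
      rw [AddChar.mulShift_apply, AddChar.one_apply, ← h2]
      congr 1
      simp
      ring
    · intro hM
      ext B
      obtain ⟨N, hN⟩ := exists_sub_transpose B.2
      change ψ (a * (B.1 * M).trace) = 1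
      have h : (Nᵀ * M).trace = (N * M).trace := by
        rw [← Matrix.trace_transpose, Matrix.transpose_mul, Matrix.transpose_transpose, hM.eq,
          Matrix.trace_mul_comm]
      rw [hN, Matrix.sub_mul, Matrix.trace_sub, h, sub_self, mul_zero, AddChar.map_zero_eq_one]
  have h := AddChar.sum_eq_ite χ
  rw [Nat.card_eq_fintype_card]
  simp only [hχ] at h
  exact h.trans (by congr)

end AlternatingMatrices

/-! ### The parabolic subgroup and the isometries of the hyperbolic form -/

section Parabolic

variable {F : Type*} [Field F] {ι κ : Type*} [Fintype ι] [DecidableEq ι] [Fintype κ]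
  [DecidableEq κ]

/-- The element `[A, 0; 0, ᵗA⁻¹] [1, B; 0, 1] = [A, A B; 0, ᵗA⁻¹]` of the parabolic subgroup. -/
def parabolicElt (A : GL ι F) (B : Matrix ι ι F) : GL (ι ⊕ ι) F where
  val := fromBlocks A.1 (A.1 * B) 0 A.2ᵀ
  inv := fromBlocks A.2 (-(B * A.1ᵀ)) 0 A.1ᵀ
  val_inv := by
    rw [fromBlocks_multiply, ← Matrix.transpose_mul, A.val_inv]
    simp [Matrix.mul_assoc]
  inv_val := by
    rw [fromBlocks_multiply, ← Matrix.transpose_mul, A.inv_val, ← Matrix.mul_assoc,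
      A.inv_val, Matrix.neg_mul _ A.2ᵀ, Matrix.mul_assoc B A.1ᵀ A.2ᵀ, ← Matrix.transpose_mul,
      A.inv_val]
    simp

theorem parabolicElt_injective {A A' : GL ι F} {B B' : Matrix ι ι F}
    (h : parabolicElt A B = parabolicElt A' B') : A = A' ∧ B = B' := by
  obtain ⟨h1, h2, -, -⟩ := fromBlocks_inj.mp (congrArg Units.val h)
  have hA : A = A' := Units.ext h1
  subst hA
  refine ⟨rfl, ?_⟩
  have := congrArg (A.2 * ·) h2
  simpa only [← Matrix.mul_assoc, A.inv_val, Matrix.one_mul] using this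

theorem parabolicElt_mul (A A' : GL ι F) (B B' : Matrix ι ι F) :
    parabolicElt A B * parabolicElt A' B' = parabolicElt (A * A') (B' + A'.2 * B * A'.2ᵀ) := by
  refine Units.ext ?_
  change fromBlocks _ _ _ _ * fromBlocks _ _ _ _ =
    fromBlocks (A.1 * A'.1) ((A.1 * A'.1) * _) _ (A'.2 * A.2)ᵀ
  have h : A.1 * A'.1 * (A'.2 * B * A'.2ᵀ) = A.1 * B * A'.2ᵀ := by
    rw [Matrix.mul_assoc A.1, ← Matrix.mul_assoc A'.1, ← Matrix.mul_assoc A'.1, A'.val_inv,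
      Matrix.one_mul, Matrix.mul_assoc]
  rw [fromBlocks_multiply, Matrix.mul_add, h, ← Matrix.mul_assoc, Matrix.transpose_mul]
  simp

theorem parabolicElt_inv (A : GL ι F) (B : Matrix ι ι F) :
    (parabolicElt A B)⁻¹ = parabolicElt A⁻¹ (-(A.1 * B * A.1ᵀ)) := by
  refine Units.ext ?_
  change fromBlocks _ _ _ _ = fromBlocks A.2 (A.2 * _) 0 A.1ᵀ
  rw [Matrix.mul_neg, Matrix.mul_assoc A.1, ← Matrix.mul_assoc A.2, A.inv_val, Matrix.one_mul]

/-- The maximal parabolic subgroup `P⁺`, with rows and columns indexed by two copies of an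
arbitrary finite type. -/
def parabolic (ι F : Type*) [Field F] [Fintype ι] [DecidableEq ι] : Subgroup (GL (ι ⊕ ι) F) where
  carrier := {g | ∃ A : GL ι F, ∃ B ∈ altMatrix ι F, g = parabolicElt A B}
  one_mem' := ⟨1, 0, zero_mem _, Units.ext (by
    change 1 = fromBlocks 1 (1 * 0) 0 (1 : Matrix ι ι F)ᵀ
    simp)⟩
  mul_mem' := by
    rintro _ _ ⟨A, B, hB, rfl⟩ ⟨A', B', hB', rfl⟩
    exact ⟨A * A', _, add_mem hB' (conj_mem_altMatrix hB A'.2), parabolicElt_mul A A' B B'⟩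
  inv_mem' := by
    rintro _ ⟨A, B, hB, rfl⟩
    exact ⟨A⁻¹, _, neg_mem (conj_mem_altMatrix hB A.1), parabolicElt_inv A B⟩

/-- The bijection between pairs `(A, B)` and elements of the parabolic subgroup. -/
noncomputable def parabolicEquiv : GL ι F × altMatrix ι F ≃ parabolic ι F :=
  Equiv.ofBijective (fun p => ⟨parabolicElt p.1 p.2.1, p.1, p.2.1, p.2.2, rfl⟩) (by
    constructor
    · rintro ⟨A, B⟩ ⟨A', B'⟩ h
      obtain ⟨rfl, hB⟩ := parabolicElt_injective (congrArg Subtype.val h)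
      exact Prod.ext rfl (Subtype.ext hB)
    · rintro ⟨_, A, B, hB, rfl⟩
      exact ⟨(A, ⟨B, hB⟩), rfl⟩)

/-- The Gram matrix `[0, 1; 0, 0]` of the quadratic form `∑ xᵢ xₙ₊ᵢ`. -/
def hyperbolicGram (ι F : Type*) [Field F] [DecidableEq ι] : Matrix (ι ⊕ ι) (ι ⊕ ι) F :=
  fromBlocks 0 1 0 0

/-- The matrix `g` preserves the quadratic form `∑ xᵢ xₙ₊ᵢ`: two Gram matrices define the same
form when they differ by an alternating matrix. -/
def PreservesForm (g : Matrix (ι ⊕ ι) (ι ⊕ ι) F) : Prop :=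
  gᵀ * hyperbolicGram ι F * g - hyperbolicGram ι F ∈ altMatrix (ι ⊕ ι) F

theorem PreservesForm.mul {g h : Matrix (ι ⊕ ι) (ι ⊕ ι) F} (hg : PreservesForm g)
    (hh : PreservesForm h) : PreservesForm (g * h) := by
  have h1 := add_mem (conj_mem_altMatrix hg hᵀ) hh
  have h2 : (g * h)ᵀ * hyperbolicGram ι F * (g * h) - hyperbolicGram ι F
      = hᵀ * (gᵀ * hyperbolicGram ι F * g - hyperbolicGram ι F) * hᵀᵀ
        + (hᵀ * hyperbolicGram ι F * h - hyperbolicGram ι F) := by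
    simp only [Matrix.transpose_mul, Matrix.transpose_transpose, Matrix.mul_sub, Matrix.sub_mul,
      Matrix.mul_assoc]
    abel
  rw [PreservesForm, h2]
  exact h1

theorem preservesForm_fromBlocks_iff {a b c d : Matrix ι ι F} :
    PreservesForm (fromBlocks a b c d) ↔
      aᵀ * c ∈ altMatrix ι F ∧ bᵀ * d ∈ altMatrix ι F ∧ bᵀ * c = -(aᵀ * d - 1)ᵀ := by
  have h : (fromBlocks a b c d)ᵀ * hyperbolicGram ι F * fromBlocks a b c d - hyperbolicGram ι F
      = fromBlocks (aᵀ * c) (aᵀ * d - 1) (bᵀ * c) (bᵀ * d) := by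
    rw [hyperbolicGram, fromBlocks_transpose, fromBlocks_multiply, fromBlocks_multiply]
    ext (i | i) (j | j) <;> simp
  rw [PreservesForm, h, fromBlocks_mem_altMatrix]

theorem preservesForm_parabolicElt (A : GL ι F) {B : Matrix ι ι F} (hB : B ∈ altMatrix ι F) :
    PreservesForm (parabolicElt A B).1 := by
  refine preservesForm_fromBlocks_iff.mpr ⟨by simp, ?_, ?_⟩
  · rw [Matrix.transpose_mul, Matrix.mul_assoc, ← Matrix.transpose_mul, A.inv_val]
    refine ⟨fun i => by simpa using hB.1 i, fun i j => by simpa using hB.2 j i⟩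
  · rw [← Matrix.transpose_mul, A.inv_val]
    simp

/-- The parabolic subgroup consists of the isometries with vanishing lower left block. -/
theorem mem_parabolic_iff {g : GL (ι ⊕ ι) F} (hg : PreservesForm g.1) :
    g ∈ parabolic ι F ↔ g.1.toBlocks₂₁ = 0 := by
  constructor
  · rintro ⟨A, B, -, rfl⟩
    rfl
  · intro h0
    obtain ⟨a, b, c, d, hblocks⟩ : ∃ a b c d, g.1 = fromBlocks a b c d :=
      ⟨_, _, _, _, (fromBlocks_toBlocks g.1).symm⟩
    rw [hblocks, toBlocks_fromBlocks₂₁] at h0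
    subst h0
    rw [hblocks] at hg
    obtain ⟨-, h1, h2⟩ := preservesForm_fromBlocks_iff.mp hg
    have h3 : dᵀ * a = 1 := by
      rw [Matrix.mul_zero, eq_comm, neg_eq_zero, Matrix.transpose_eq_zero, sub_eq_zero] at h2
      rw [← Matrix.transpose_one, ← h2, Matrix.transpose_mul, Matrix.transpose_transpose]
    have h4 : a * dᵀ = 1 := mul_eq_one_comm.mp h3
    refine ⟨⟨a, dᵀ, h4, h3⟩, dᵀ * b, ?_, Units.ext ?_⟩
    · have h5 : dᵀ * b = (bᵀ * d)ᵀ := by rw [Matrix.transpose_mul, Matrix.transpose_transpose]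
      rw [h5]
      exact ⟨fun i => h1.1 i, fun i j => h1.2 j i⟩
    · rw [hblocks]
      change _ = fromBlocks a (a * (dᵀ * b)) 0 dᵀᵀ
      rw [← Matrix.mul_assoc, h4, Matrix.one_mul, Matrix.transpose_transpose]

end Parabolic

/-! ### The Weyl element and the block lower triangular matrices -/

section Cells

variable {F : Type*} [Field F] {m k : Type*} [Fintype m] [DecidableEq m] [Fintype k]
  [DecidableEq k]

/-- The isometry exchanging the two copies of each basis vector indexed by `m`, and fixing the
basis vectors indexed by `k`. -/
def sigmaElt (m k F : Type*) [Field F] [Fintype m] [DecidableEq m] [Fintype k]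
    [DecidableEq k] : GL ((m ⊕ k) ⊕ (m ⊕ k)) F where
  val := fromBlocks (fromBlocks 0 0 0 1) (fromBlocks 1 0 0 0) (fromBlocks 1 0 0 0)
    (fromBlocks 0 0 0 1)
  inv := fromBlocks (fromBlocks 0 0 0 1) (fromBlocks 1 0 0 0) (fromBlocks 1 0 0 0)
    (fromBlocks 0 0 0 1)
  val_inv := by simp [fromBlocks_multiply, fromBlocks_add]
  inv_val := by simp [fromBlocks_multiply, fromBlocks_add]

theorem sigmaElt_inv : (sigmaElt m k F)⁻¹ = sigmaElt m k F := rfl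

theorem preservesForm_sigmaElt : PreservesForm (sigmaElt m k F).1 := by
  refine preservesForm_fromBlocks_iff.mpr ⟨?_, ?_, ?_⟩
  · simp [fromBlocks_multiply, fromBlocks_transpose, zero_mem]
  · simp [fromBlocks_multiply, fromBlocks_transpose, zero_mem]
  · rw [← fromBlocks_one]
    simp only [fromBlocks_transpose, fromBlocks_multiply, sub_eq_add_neg, fromBlocks_neg,
      fromBlocks_add]
    simp

/-- The invertible block lower triangular matrix `[S, 0; X, C]`. -/
def lowerElt (S : GL m F) (C : GL k F) (X : Matrix k m F) : GL (m ⊕ k) F where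
  val := fromBlocks S.1 0 X C.1
  inv := fromBlocks S.2 0 (-(C.2 * X * S.2)) C.2
  val_inv := by
    have h : C.1 * (C.2 * X * S.2) = X * S.2 := by
      rw [Matrix.mul_assoc C.2, ← Matrix.mul_assoc C.1, C.val_inv, Matrix.one_mul]
    rw [fromBlocks_multiply, Matrix.mul_neg C.1, h, C.val_inv, S.val_inv]
    simp
  inv_val := by
    rw [fromBlocks_multiply, Matrix.neg_mul, Matrix.mul_assoc, S.inv_val, C.inv_val]
    simp

/-- Every invertible matrix with vanishing upper right block is `[S, 0; X, C]` for unique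
invertible `S` and `C`. -/
noncomputable def lowerEquiv :
    GL m F × GL k F × Matrix k m F ≃ {A : GL (m ⊕ k) F // A.1.toBlocks₁₂ = 0} :=
  Equiv.ofBijective (fun p => ⟨lowerElt p.1 p.2.1 p.2.2, rfl⟩) (by
    constructor
    · rintro ⟨S, C, X⟩ ⟨S', C', X'⟩ h
      obtain ⟨h1, -, h2, h3⟩ := fromBlocks_inj.mp (congrArg (fun A => A.1.1) h)
      exact Prod.ext (Units.ext h1) (Prod.ext (Units.ext h3) h2)
    · rintro ⟨A, hA⟩
      have hblocks : A.1 = fromBlocks A.1.toBlocks₁₁ 0 A.1.toBlocks₂₁ A.1.toBlocks₂₂ := by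
        conv_lhs => rw [← fromBlocks_toBlocks A.1, hA]
      have hu : IsUnit (fromBlocks A.1.toBlocks₁₁ 0 A.1.toBlocks₂₁ A.1.toBlocks₂₂) := by
        rw [← hblocks]; exact A.isUnit
      obtain ⟨⟨S, hS⟩, ⟨C, hC⟩⟩ := isUnit_fromBlocks_zero₁₂.mp hu
      refine ⟨(S, C, A.1.toBlocks₂₁), Subtype.ext (Units.ext ?_)⟩
      change fromBlocks S.1 0 A.1.toBlocks₂₁ C.1 = A.1
      rw [hS, hC, ← hblocks])

/-- Conjugating `[A, A B; 0, ᵗA⁻¹]` by `σ` gives an element of the parabolic subgroup exactly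
when `A` is block lower triangular and the upper left block of `B` vanishes. -/
theorem conj_sigmaElt_mem_parabolic_iff (A : GL (m ⊕ k) F) {B : Matrix (m ⊕ k) (m ⊕ k) F}
    (hB : B ∈ altMatrix (m ⊕ k) F) :
    (sigmaElt m k F)⁻¹ * parabolicElt A B * sigmaElt m k F ∈ parabolic (m ⊕ k) F ↔
      A.1.toBlocks₁₂ = 0 ∧ B.toBlocks₁₁ = 0 := by
  have hg : PreservesForm ((sigmaElt m k F)⁻¹ * parabolicElt A B * sigmaElt m k F).1 := by
    rw [sigmaElt_inv, Units.val_mul, Units.val_mul]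
    exact (preservesForm_sigmaElt.mul (preservesForm_parabolicElt A hB)).mul preservesForm_sigmaElt
  rw [mem_parabolic_iff hg]
  have h : ((sigmaElt m k F)⁻¹ * parabolicElt A B * sigmaElt m k F).1.toBlocks₂₁
      = fromBlocks (A.1 * B).toBlocks₁₁ A.1.toBlocks₁₂ (A.2ᵀ).toBlocks₂₁ 0 := by
    have hσ : (sigmaElt m k F).1 = fromBlocks (fromBlocks 0 0 0 1) (fromBlocks 1 0 0 0)
      (fromBlocks 1 0 0 0) (fromBlocks 0 0 0 1) := rfl
    have hp : (parabolicElt A B).1 = fromBlocks A.1 (A.1 * B) 0 A.2ᵀ := rfl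
    rw [sigmaElt_inv, Units.val_mul, Units.val_mul, hσ, hp]
    rw [fromBlocks_multiply, fromBlocks_multiply, toBlocks_fromBlocks₂₁]
    generalize A.1 * B = X
    generalize A.1 = Y
    generalize A.2ᵀ = Z
    conv_lhs => rw [← fromBlocks_toBlocks X, ← fromBlocks_toBlocks Y, ← fromBlocks_toBlocks Z]
    simp [fromBlocks_multiply, fromBlocks_add]
  rw [h, ← fromBlocks_zero, fromBlocks_inj]
  have hAB : A.1.toBlocks₁₂ = 0 → (A.1 * B).toBlocks₁₁ = A.1.toBlocks₁₁ * B.toBlocks₁₁ := by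
    intro hA
    conv_lhs => rw [← fromBlocks_toBlocks A.1, ← fromBlocks_toBlocks B, fromBlocks_multiply, hA]
    simp
  constructor
  · rintro ⟨h1, h2, -, -⟩
    refine ⟨h2, ?_⟩
    rw [hAB h2] at h1
    obtain ⟨⟨S, C, X⟩, hA⟩ := lowerEquiv.surjective ⟨A, h2⟩
    obtain rfl : lowerElt S C X = A := congrArg Subtype.val hA
    have h3 : S.1 * B.toBlocks₁₁ = 0 := h1
    rw [← Matrix.one_mul B.toBlocks₁₁, ← S.inv_val, Matrix.mul_assoc, h3, Matrix.mul_zero]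
  · rintro ⟨h1, h2⟩
    refine ⟨by rw [hAB h1, h2, Matrix.mul_zero], h1, ?_, rfl⟩
    obtain ⟨⟨S, C, X⟩, hA⟩ := lowerEquiv.surjective ⟨A, h1⟩
    obtain rfl : lowerElt S C X = A := congrArg Subtype.val hA
    ext i j
    rfl

variable [Fintype F]

omit [DecidableEq m] [DecidableEq k] in
theorem natCard_altMatrix_toBlocks₁₁ :
    Nat.card {B : altMatrix (m ⊕ k) F // B.1.toBlocks₁₁ = 0}
      = Fintype.card F ^ (Fintype.card m * Fintype.card k) * Nat.card (altMatrix k F) := by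
  rw [← natCard_matrix, ← Nat.card_prod]
  refine Nat.card_congr
    { toFun := fun B => (altMatrixSumEquiv.symm B.1).2
      invFun := fun p => ⟨altMatrixSumEquiv (0, p), rfl⟩
      left_inv := fun B => Subtype.ext ?_
      right_inv := fun p => rfl }
  change altMatrixSumEquiv (0, (altMatrixSumEquiv.symm B.1).2) = B.1
  rw [← Equiv.eq_symm_apply]
  refine Prod.ext (Subtype.ext ?_) rfl
  exact B.2.symm

theorem natCard_conj_sigmaElt :
    Nat.card {h : parabolic (m ⊕ k) F //
        (sigmaElt m k F)⁻¹ * (h : GL ((m ⊕ k) ⊕ (m ⊕ k)) F) * sigmaElt m k F ∈ parabolic (m ⊕ k) F}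
      = Nat.card (GL m F) * (Nat.card (GL k F) *
          Fintype.card F ^ (Fintype.card k * Fintype.card m)) *
        (Fintype.card F ^ (Fintype.card m * Fintype.card k) * Nat.card (altMatrix k F)) := by
  rw [← natCard_altMatrix_toBlocks₁₁, ← natCard_matrix, ← Nat.card_prod, ← Nat.card_prod,
    Nat.card_congr lowerEquiv, ← Nat.card_prod]
  refine Nat.card_congr (Equiv.trans ?_ (Equiv.subtypeProdEquivProd
    (p := fun A : GL (m ⊕ k) F => A.1.toBlocks₁₂ = 0)
    (q := fun B : altMatrix (m ⊕ k) F => B.1.toBlocks₁₁ = 0)))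
  exact (parabolicEquiv.subtypeEquiv fun p =>
    (conj_sigmaElt_mem_parabolic_iff p.1 p.2.2).symm).symm

end Cells

/-! ### The character sum over the parabolic subgroup -/

section CellSums

variable {F : Type*} [Field F] {m k : Type*} [Fintype m] [DecidableEq m] [Fintype k]
  [DecidableEq k]

omit [DecidableEq m] [DecidableEq k] in
theorem trace_fromBlocks (A : Matrix m m F) (B : Matrix m k F) (C : Matrix k m F)
    (D : Matrix k k F) : (fromBlocks A B C D).trace = A.trace + D.trace := by
  simp [Matrix.trace]

theorem trace_parabolicElt_mul_sigmaElt (A : GL (m ⊕ k) F) (B : Matrix (m ⊕ k) (m ⊕ k) F) :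
    (parabolicElt A B * sigmaElt m k F).1.trace
      = A.1.toBlocks₂₂.trace + A.2.toBlocks₂₂.trace
        + (B * fromBlocks A.1.toBlocks₁₁ A.1.toBlocks₁₂ 0 0).trace := by
  have hD₀ : ∀ M : Matrix (m ⊕ k) (m ⊕ k) F,
      (M * fromBlocks 0 0 0 1).trace = M.toBlocks₂₂.trace := by
    intro M
    conv_lhs => rw [← fromBlocks_toBlocks M, fromBlocks_multiply, trace_fromBlocks]
    simp
  have hD₁ : fromBlocks (1 : Matrix m m F) 0 0 (0 : Matrix k k F) * A.1
      = fromBlocks A.1.toBlocks₁₁ A.1.toBlocks₁₂ 0 0 := by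
    conv_lhs => rw [← fromBlocks_toBlocks A.1, fromBlocks_multiply]
    simp
  change (fromBlocks A.1 (A.1 * B) 0 A.2ᵀ * fromBlocks (fromBlocks 0 0 0 1) (fromBlocks 1 0 0 0)
    (fromBlocks 1 0 0 0) (fromBlocks 0 0 0 1)).trace = _
  rw [fromBlocks_multiply, trace_fromBlocks, trace_add, trace_add, hD₀, hD₀, Matrix.zero_mul,
    trace_zero, Matrix.mul_assoc, trace_mul_comm A.1, Matrix.mul_assoc, hD₁]
  have h : A.2ᵀ.toBlocks₂₂.trace = A.2.toBlocks₂₂.trace := rfl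
  rw [h]
  ring

variable [Fintype F] [DecidableEq F]

theorem sum_GL_isSymm [DecidablePred fun S : GL m F => S.1.IsSymm] :
    ∑ S : GL m F, (if S.1.IsSymm then (1 : ℂ) else 0) = symmUnitCount m F := by
  classical
  have h := sum_GL_eq_sum_ite (n := m) (F := F) fun M _ => if M.IsSymm then (1 : ℂ) else 0
  rw [symmUnitCount, Nat.cast_sum]
  refine Eq.trans (Finset.sum_congr rfl fun S _ => by congr) (h.trans ?_)
  refine (Fintype.sum_of_injective (Subtype.val : SymmMatrix m F → Matrix m m F)
    Subtype.val_injective _ _ ?_ ?_).symm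
  · intro M hM
    have hM' : ¬ M.IsSymm := fun h' => hM ⟨⟨M, h'⟩, rfl⟩
    simp [hM']
  · intro M
    simp [M.2]

/-- Summing over the unipotent part first forces the first rows of `A` to be `[S, 0]` with `S`
symmetric, after which the summand depends only on the lower right block `C` of `A`. -/
theorem sum_parabolic_addChar {ψ : AddChar F ℂ} (hψ : ψ.IsPrimitive) {a : F} (ha : a ≠ 0)
    [Fintype (parabolic (m ⊕ k) F)] :
    ∑ p : parabolic (m ⊕ k) F, ψ (a * (p.1 * sigmaElt m k F).1.trace)
      = Nat.card (altMatrix (m ⊕ k) F) * (symmUnitCount m F *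
        ((Fintype.card F : ℂ) ^ (Fintype.card k * Fintype.card m) *
          ∑ C : GL k F, ψ (a * (C.1.trace + C.2.trace)))) := by
  classical
  let T : GL (m ⊕ k) F → Matrix (m ⊕ k) (m ⊕ k) F := fun A =>
    fromBlocks A.1.toBlocks₁₁ A.1.toBlocks₁₂ 0 0
  let d : GL (m ⊕ k) F → ℂ := fun A => ψ (a * (A.1.toBlocks₂₂.trace + A.2.toBlocks₂₂.trace))
  have hsum : ∀ A : GL (m ⊕ k) F,
      ∑ B : altMatrix (m ⊕ k) F, ψ (a * (parabolicElt A B.1 * sigmaElt m k F).1.trace)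
        = Nat.card (altMatrix (m ⊕ k) F) * if (T A).IsSymm then d A else 0 := by
    intro A
    have h : ∀ B : altMatrix (m ⊕ k) F, ψ (a * (parabolicElt A B.1 * sigmaElt m k F).1.trace)
        = d A * ψ (a * (B.1 * T A).trace) := by
      intro B
      rw [trace_parabolicElt_mul_sigmaElt, mul_add, AddChar.map_add_eq_mul]
    rw [Finset.sum_congr rfl fun B _ => h B, ← Finset.mul_sum, sum_altMatrix_addChar hψ ha]
    split_ifs <;> ring
  have hT : ∀ A : GL (m ⊕ k) F, (T A).IsSymm ↔ A.1.toBlocks₁₂ = 0 ∧ A.1.toBlocks₁₁.IsSymm := by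
    intro A
    rw [Matrix.isSymm_fromBlocks_iff]
    constructor
    · rintro ⟨h1, h2, -, -⟩
      exact ⟨by simpa using h2, h1⟩
    · rintro ⟨h1, h2⟩
      exact ⟨h2, by simp [h1], by simp [h1], by simp⟩
  have hlower : ∑ A : GL (m ⊕ k) F, (if (T A).IsSymm then d A else 0)
      = ∑ p : GL m F × GL k F × Matrix k m F,
          (if p.1.1.IsSymm then (1 : ℂ) else 0) * ψ (a * (p.2.1.1.trace + p.2.1.2.trace)) := by
    refine (Fintype.sum_of_injective
      (fun p : GL m F × GL k F × Matrix k m F => (lowerEquiv p).1)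
      (Subtype.val_injective.comp lowerEquiv.injective) _ _ ?_ ?_).symm
    · intro A hA
      refine if_neg fun h => hA ?_
      obtain ⟨p, hp⟩ := lowerEquiv.surjective ⟨A, ((hT A).mp h).1⟩
      exact ⟨p, congrArg Subtype.val hp⟩
    · rintro ⟨S, C, X⟩
      have h1 : (T (lowerEquiv (S, C, X)).1).IsSymm ↔ S.1.IsSymm :=
        (hT _).trans (and_iff_right rfl)
      have h2 : d (lowerEquiv (S, C, X)).1 = ψ (a * (C.1.trace + C.2.trace)) := rfl
      rw [h2, ite_mul, one_mul, zero_mul]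
      exact (if_congr h1 rfl rfl).symm
  have hX : Fintype.card (Matrix k m F) = Fintype.card F ^ (Fintype.card k * Fintype.card m) := by
    rw [← Nat.card_eq_fintype_card, natCard_matrix]
  rw [← parabolicEquiv.sum_comp, Fintype.sum_prod_type]
  refine (Finset.sum_congr rfl fun A _ => hsum A).trans ?_
  rw [← Finset.mul_sum, hlower, Fintype.sum_prod_type]
  congr 1
  have hC : ∑ p : GL k F × Matrix k m F, ψ (a * (p.1.1.trace + p.1.2.trace))
      = (Fintype.card F : ℂ) ^ (Fintype.card k * Fintype.card m) *
          ∑ C : GL k F, ψ (a * (C.1.trace + C.2.trace)) := by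
    rw [Fintype.sum_prod_type]
    simp only [Finset.sum_const, Finset.card_univ, hX, nsmul_eq_mul]
    rw [← Finset.mul_sum]
    push_cast
    rfl
  rw [← hC, ← sum_GL_isSymm, Finset.sum_mul_sum]

/-- The sum over a Bruhat cell, indexed by two finite types `m` and `k`. -/
theorem sum_doubleCoset_addChar {ψ : AddChar F ℂ} (hψ : ψ.IsPrimitive) {a : F} (ha : a ≠ 0)
    (D : Finset (GL ((m ⊕ k) ⊕ (m ⊕ k)) F))
    (hD : ∀ w, w ∈ D ↔ w ∈ DoubleCoset.doubleCoset (sigmaElt m k F)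
      (parabolic (m ⊕ k) F : Set (GL ((m ⊕ k) ⊕ (m ⊕ k)) F)) (parabolic (m ⊕ k) F)) :
    (Nat.card (GL m F) : ℂ) * Nat.card (GL k F) * ∑ w ∈ D, ψ (a * w.1.trace)
      = Nat.card (GL (m ⊕ k) F) * Nat.card (altMatrix (m ⊕ k) F) * Nat.card (altMatrix m F) *
        symmUnitCount m F * ∑ C : GL k F, ψ (a * (C.1.trace + C.2.trace)) := by
  classical
  have : Fintype (parabolic (m ⊕ k) F) := Fintype.ofFinite _
  have h := card_mul_sum_doubleCoset (parabolic (m ⊕ k) F) (sigmaElt m k F)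
    (fun w => ψ (a * w.1.trace)) (fun x y => by
      simp only [Units.val_mul]
      rw [trace_mul_comm]) D hD
  have hP : Fintype.card (parabolic (m ⊕ k) F)
      = Nat.card (GL (m ⊕ k) F) * Nat.card (altMatrix (m ⊕ k) F) := by
    rw [← Nat.card_eq_fintype_card, ← Nat.card_congr parabolicEquiv, Nat.card_prod]
  rw [sum_parabolic_addChar hψ ha, natCard_conj_sigmaElt, hP] at h
  have halt : (Nat.card (altMatrix (m ⊕ k) F) : ℂ) = Nat.card (altMatrix m F) *
      ((Fintype.card F : ℂ) ^ (Fintype.card m * Fintype.card k) * Nat.card (altMatrix k F)) := by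
    rw [natCard_altMatrix_sum]; push_cast; rfl
  have hk : (Nat.card (altMatrix k F) : ℂ) ≠ 0 := by exact_mod_cast Nat.card_pos.ne'
  have hq : (Fintype.card F : ℂ) ≠ 0 := by exact_mod_cast Fintype.card_ne_zero
  push_cast at h
  rw [mul_comm (Fintype.card k)] at h
  refine mul_left_cancel₀ (mul_ne_zero (pow_ne_zero (Fintype.card m * Fintype.card k) hq)
    (mul_ne_zero (pow_ne_zero (Fintype.card m * Fintype.card k) hq) hk)) ?_
  rw [halt] at h ⊢
  linear_combination h

end CellSums

/-! ### Passage to indices in `Fin n` -/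

section Reindexing

variable {F : Type*} [Field F] {ι κ : Type*} [Fintype ι] [DecidableEq ι] [Fintype κ]
  [DecidableEq κ]

/-- Renaming the index type of a general linear group. -/
def reindexGL (F : Type*) [Field F] (e : ι ≃ κ) : GL ι F ≃* GL κ F :=
  Units.mapEquiv (Matrix.reindexAlgEquiv F F e).toMulEquiv

theorem reindexGL_parabolicElt (e : ι ≃ κ) (A : GL ι F) (B : Matrix ι ι F) :
    reindexGL F (e.sumCongr e) (parabolicElt A B)
      = parabolicElt (reindexGL F e A) (Matrix.reindex e e B) := by
  refine Units.ext ?_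
  have h : (reindexGL F e A).1 * Matrix.reindex e e B = Matrix.reindex e e (A.1 * B) :=
    ((Matrix.reindexAlgEquiv F F e).map_mul A.1 B).symm
  change Matrix.reindex _ _ (fromBlocks A.1 (A.1 * B) 0 A.2ᵀ) =
    fromBlocks (Matrix.reindex e e A.1) _ 0 (Matrix.reindex e e A.2)ᵀ
  rw [h]
  ext (i | i) (j | j) <;> rfl

theorem reindexGL_mem_parabolic_iff (e : ι ≃ κ) {g : GL (ι ⊕ ι) F} :
    reindexGL F (e.sumCongr e) g ∈ parabolic κ F ↔ g ∈ parabolic ι F := by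
  constructor
  · rintro ⟨A, B, hB, h⟩
    refine ⟨(reindexGL F e).symm A, _, ((altMatrixCongr e).symm ⟨B, hB⟩).2, ?_⟩
    refine (reindexGL F (e.sumCongr e)).injective ?_
    rw [h, reindexGL_parabolicElt, MulEquiv.apply_symm_apply]
    congr 1
    exact (congrArg Subtype.val ((altMatrixCongr e).apply_symm_apply ⟨B, hB⟩)).symm
  · rintro ⟨A, B, hB, rfl⟩
    exact ⟨_, _, ((altMatrixCongr e) ⟨B, hB⟩).2, reindexGL_parabolicElt e A B⟩

theorem mem_parabolicPlus_iff {n : ℕ} {w : Matrix (Fin n ⊕ Fin n) (Fin n ⊕ Fin n) F} :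
    w ∈ parabolicPlus n F ↔ ∃ g ∈ parabolic (Fin n) F, w = g.1 := by
  have h : ∀ (A : GL (Fin n) F) (B : Matrix (Fin n) (Fin n) F),
      fromBlocks (A : Matrix (Fin n) (Fin n) F) 0 0
          ((A⁻¹ : GL (Fin n) F) : Matrix (Fin n) (Fin n) F)ᵀ * fromBlocks 1 B 0 1
        = (parabolicElt A B).1 := by
    intro A B
    change _ = fromBlocks A.1 (A.1 * B) 0 A.2ᵀ
    rw [fromBlocks_multiply]
    simp [Units.inv_eq_val_inv]
  constructor
  · rintro ⟨A, B, hB, rfl⟩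
    exact ⟨_, ⟨A, B, hB, rfl⟩, h A B⟩
  · rintro ⟨_, ⟨A, B, hB, rfl⟩, rfl⟩
    exact ⟨A, B, hB, (h A B).symm⟩

theorem reindexGL_sigmaElt (s t : ℕ) :
    (reindexGL F ((finSumFinEquiv (m := s) (n := t)).sumCongr finSumFinEquiv)
      (sigmaElt (Fin s) (Fin t) F)).1 = sigmaPlus (s + t) s F := by
  have h0 : Matrix.reindex (finSumFinEquiv (m := s) (n := t)) finSumFinEquiv
      (fromBlocks 0 0 0 (1 : Matrix (Fin t) (Fin t) F))
        = diagonal fun i : Fin (s + t) => if i.val < s then (0 : F) else 1 := by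
    rw [← Equiv.eq_symm_apply]
    ext (i | i) (j | j) <;> simp [Matrix.diagonal_apply, Matrix.one_apply, Fin.ext_iff]; omega
  have h1 : Matrix.reindex (finSumFinEquiv (m := s) (n := t)) finSumFinEquiv
      (fromBlocks (1 : Matrix (Fin s) (Fin s) F) 0 0 0)
        = diagonal fun i : Fin (s + t) => if i.val < s then (1 : F) else 0 := by
    rw [← Equiv.eq_symm_apply]
    ext (i | i) (j | j) <;> simp [Matrix.diagonal_apply, Matrix.one_apply, Fin.ext_iff]; omega
  rw [sigmaPlus, ← h0, ← h1]
  change Matrix.reindex _ _ (fromBlocks _ _ _ _) = _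
  ext (i | i) (j | j) <;> rfl

variable [Fintype F] [DecidableEq F]

/-- The sum over `P⁺ σ_s⁺ P⁺` in terms of group orders, the number of invertible symmetric
`s × s` matrices and a sum over `GL_t`, where `t = n - s`. -/
theorem sum_bruhatCell_addChar {ψ : AddChar F ℂ} (hψ : ψ.IsPrimitive) {a : F} (ha : a ≠ 0)
    (s t : ℕ) :
    (Nat.card (GL (Fin s) F) : ℂ) * Nat.card (GL (Fin t) F) *
        ∑ w ∈ bruhatCell (s + t) s F, ψ (a * w.trace)
      = Nat.card (GL (Fin (s + t)) F) * (Fintype.card F : ℂ) ^ (s + t).choose 2 *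
        (Fintype.card F : ℂ) ^ s.choose 2 * symmUnitCount (Fin s) F *
        ∑ C : GL (Fin t) F, ψ (a * (C.1.trace + C.2.trace)) := by
  classical
  let e : Fin s ⊕ Fin t ≃ Fin (s + t) := finSumFinEquiv
  let Φ := reindexGL F (e.sumCongr e)
  let D : Finset (GL ((Fin s ⊕ Fin t) ⊕ (Fin s ⊕ Fin t)) F) := Finset.univ.filter fun w =>
    w ∈ DoubleCoset.doubleCoset (sigmaElt (Fin s) (Fin t) F)
      (parabolic (Fin s ⊕ Fin t) F : Set (GL _ F)) (parabolic (Fin s ⊕ Fin t) F)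
  have h := sum_doubleCoset_addChar hψ ha D (by simp [D])
  have hsum : ∑ w ∈ bruhatCell (s + t) s F, ψ (a * w.trace) = ∑ w ∈ D, ψ (a * w.1.trace) := by
    symm
    refine Finset.sum_bij (fun w _ => (Φ w).1) ?_ ?_ ?_ ?_
    · intro w hw
      obtain ⟨x, hx, y, hy, rfl⟩ := DoubleCoset.mem_doubleCoset.mp (Finset.mem_filter.mp hw).2
      rw [bruhatCell, Set.Finite.mem_toFinset, DoubleCoset.mem_doubleCoset]
      refine ⟨_, mem_parabolicPlus_iff.mpr ⟨Φ x, (reindexGL_mem_parabolic_iff e).mpr hx, rfl⟩,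
        _, mem_parabolicPlus_iff.mpr ⟨Φ y, (reindexGL_mem_parabolic_iff e).mpr hy, rfl⟩, ?_⟩
      rw [map_mul, map_mul, Units.val_mul, Units.val_mul, ← reindexGL_sigmaElt]
    · intro w _ w' _ hww
      exact Φ.injective (Units.ext hww)
    · intro w hw
      rw [bruhatCell, Set.Finite.mem_toFinset, DoubleCoset.mem_doubleCoset] at hw
      obtain ⟨x, hx, y, hy, rfl⟩ := hw
      obtain ⟨x, hx', rfl⟩ := mem_parabolicPlus_iff.mp hx
      obtain ⟨y, hy', rfl⟩ := mem_parabolicPlus_iff.mp hy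
      obtain ⟨x, rfl⟩ := Φ.surjective x
      obtain ⟨y, rfl⟩ := Φ.surjective y
      refine ⟨x * sigmaElt (Fin s) (Fin t) F * y, Finset.mem_filter.mpr ⟨Finset.mem_univ _,
        DoubleCoset.mem_doubleCoset.mpr ⟨x, (reindexGL_mem_parabolic_iff e).mp hx', y,
          (reindexGL_mem_parabolic_iff e).mp hy', rfl⟩⟩, ?_⟩
      rw [map_mul, map_mul, Units.val_mul, Units.val_mul, ← reindexGL_sigmaElt]
    · intro w _
      congr 2
      exact (Equiv.sum_comp (e.sumCongr e).symm fun i => w.1 i i).symm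
  rw [hsum, h, Nat.card_congr (reindexGL F e).toEquiv, Nat.card_congr (altMatrixCongr e),
    natCard_altMatrix_fin, natCard_altMatrix_fin]
  push_cast
  rfl

end Reindexing

/-! ### Evaluation of the constants -/

section Evaluation

variable {F : Type*} [Field F] [Fintype F]

theorem natCard_GL_succ (s : ℕ) :
    (Nat.card (GL (Fin (s + 1)) F) : ℂ) = ((Fintype.card F : ℂ) ^ (s + 1) - 1) *
      (Fintype.card F : ℂ) ^ s * Nat.card (GL (Fin s) F) := by
  classical
  have h : ∀ n : ℕ, (Nat.card (GL (Fin n) F) : ℂ)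
      = ∏ i : Fin n, ((Fintype.card F : ℂ) ^ n - (Fintype.card F : ℂ) ^ (i : ℕ)) := by
    intro n
    rw [Matrix.card_GL_field, Nat.cast_prod]
    refine Finset.prod_congr rfl fun i _ => ?_
    rw [Nat.cast_sub (Nat.pow_le_pow_right Fintype.card_pos i.2.le)]
    push_cast
    rfl
  rw [h, h, Fin.prod_univ_succ]
  have h2 : ∀ i : Fin s, (Fintype.card F : ℂ) ^ (s + 1) - (Fintype.card F : ℂ) ^ (i.succ : ℕ)
      = (Fintype.card F : ℂ) * ((Fintype.card F : ℂ) ^ s - (Fintype.card F : ℂ) ^ (i : ℕ)) := by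
    intro i
    rw [Fin.val_succ]
    ring
  rw [Finset.prod_congr rfl fun i _ => h2 i, Finset.prod_mul_distrib]
  simp
  ring

theorem natCard_GL_ne_zero (s : ℕ) : (Nat.card (GL (Fin s) F) : ℂ) ≠ 0 := by
  classical
  exact_mod_cast Nat.card_pos.ne'

theorem natCard_GL_one : (Nat.card (GL (Fin 1) F) : ℂ) = Fintype.card F - 1 := by
  have h := natCard_GL_succ (F := F) 0
  simpa using h

theorem natCard_GL_two : (Nat.card (GL (Fin 2) F) : ℂ)
    = ((Fintype.card F : ℂ) ^ 2 - 1) * Fintype.card F * (Fintype.card F - 1) := by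
  rw [natCard_GL_succ, natCard_GL_one, pow_one]

variable [DecidableEq F] {ψ : AddChar F ℂ}

theorem sum_bruhatCell_one [CharP F 2] (hψ : ψ.IsPrimitive) (hsq : ∀ x, ψ (x ^ 2) = ψ x)
    {a : F} (ha : a ≠ 0) (s : ℕ) :
    ∑ w ∈ bruhatCell (s + 1) s F, ψ (a * w.trace)
      = (Fintype.card F : ℂ) ^ (s + (s + 1).choose 2 + s.choose 2) *
        qBinom (Fintype.card F) (s + 1) 1 * symmUnitCount (Fin s) F * kloostermanSum 1 ψ a := by
  have h := sum_bruhatCell_addChar hψ ha s 1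
  have hK : ∑ C : GL (Fin 1) F, ψ (a * (C.1.trace + C.2.trace)) = kloostermanSum 1 ψ a :=
    sum_GL_one hsq ha
  have h1 := natCard_GL_ne_zero (F := F) 1
  rw [natCard_GL_one] at h h1
  rw [hK, natCard_GL_succ] at h
  refine mul_left_cancel₀ (mul_ne_zero (natCard_GL_ne_zero (F := F) s) h1) ?_
  rw [h]
  simp only [qBinom, Finset.prod_range_one, Nat.sub_zero, pow_one]
  field_simp
  ring

theorem sum_bruhatCell_two [CharP F 2] (hψ : ψ.IsPrimitive) (hsq : ∀ x, ψ (x ^ 2) = ψ x)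
    {a : F} (ha : a ≠ 0) (s : ℕ) :
    ∑ w ∈ bruhatCell (s + 2) s F, ψ (a * w.trace)
      = (Fintype.card F : ℂ) ^ (2 * s + 1 + (s + 2).choose 2 + s.choose 2) *
        qBinom (Fintype.card F) (s + 2) 2 * symmUnitCount (Fin s) F *
        (kloostermanSum 1 ψ a ^ 2 + (Fintype.card F : ℂ) ^ 2 - Fintype.card F) := by
  have h := sum_bruhatCell_addChar hψ ha s 2
  have hK : ∑ C : GL (Fin 2) F, ψ (a * (C.1.trace + C.2.trace)) = _ := sum_GL_two hψ hsq ha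
  have h2 := natCard_GL_ne_zero (F := F) 2
  have h1 := natCard_GL_ne_zero (F := F) 1
  rw [natCard_GL_one] at h1
  rw [natCard_GL_two] at h h2
  rw [hK, natCard_GL_succ, natCard_GL_succ] at h
  refine mul_left_cancel₀ (mul_ne_zero (natCard_GL_ne_zero (F := F) s) h2) ?_
  rw [h]
  have h3 : (Fintype.card F : ℂ) ^ 2 - 1 ≠ 0 := left_ne_zero_of_mul (left_ne_zero_of_mul h2)
  simp only [qBinom, Finset.prod_range_succ, Finset.prod_range_zero, Nat.sub_zero, pow_one,
    show s + 2 - 1 = s + 1 by omega, show 2 - 1 = 1 from rfl, one_mul]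
  field_simp
  ring

end Evaluation

theorem two_mul_choose_two_add_self (n : ℕ) : 2 * n.choose 2 + n = n * n := by
  induction n with
  | zero => rfl
  | succ n ih => rw [Nat.choose_succ_succ' n 1, Nat.choose_one_right]; linarith

theorem sub_div_four_eq {a b e : ℕ} (h : a = 4 * e + b) : (a - b) / 4 = e := by
  omega

theorem corollary7 (r q : ℕ) (hr : 0 < r) (hq : q = 2 ^ r)
    (F : Type*) [Field F] [Fintype F] [DecidableEq F] [Algebra (ZMod 2) F]
    (hF : Fintype.card F = q) (a : F) (ha : a ≠ 0) :
    (∀ n : ℕ, 2 ≤ n → Even n →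
      ∑ w ∈ DC₁ n F, canonicalChar F (a * w.trace)
        = A₁plus n q * kloostermanSum 1 (canonicalChar F) a) ∧
    (∀ n : ℕ, 1 ≤ n → Odd n →
      ∑ w ∈ DC₁ n F, canonicalChar F (a * w.trace)
        = A₁minus n q * kloostermanSum 1 (canonicalChar F) a) ∧
    (∀ n : ℕ, 2 ≤ n → Even n →
      ∑ w ∈ DC₂ n F, canonicalChar F (a * w.trace)
          = A₂plus n q * (kloostermanSum 1 (canonicalChar F) a ^ 2 + (q : ℂ) ^ 2 - q) ∧
        A₂plus n q * (kloostermanSum 1 (canonicalChar F) a ^ 2 + (q : ℂ) ^ 2 - q)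
          = A₂plus n q * (kloostermanSum 2 (canonicalChar F) a + (q : ℂ) ^ 2)) ∧
    (∀ n : ℕ, 3 ≤ n → Odd n →
      ∑ w ∈ DC₂ n F, canonicalChar F (a * w.trace)
          = A₂minus n q * (kloostermanSum 1 (canonicalChar F) a ^ 2 + (q : ℂ) ^ 2 - q) ∧
        A₂minus n q * (kloostermanSum 1 (canonicalChar F) a ^ 2 + (q : ℂ) ^ 2 - q)
          = A₂minus n q * (kloostermanSum 2 (canonicalChar F) a + (q : ℂ) ^ 2)) := by

  classical
  have : CharP F 2 := charP_of_injective_algebraMap (algebraMap (ZMod 2) F).injective 2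
  have hψ := canonicalChar_isPrimitive (F := F)
  have hsq := canonicalChar_sq (F := F)
  have hK₂ : kloostermanSum 1 (canonicalChar F) a ^ 2 + (q : ℂ) ^ 2 - q
      = kloostermanSum 2 (canonicalChar F) a + (q : ℂ) ^ 2 := by
    rw [kloostermanSum_two_eq hψ hsq ha, hF]
    ring
  refine ⟨?_, ?_, ?_, ?_⟩
  · rintro n hn ⟨k, rfl⟩
    obtain ⟨k, rfl⟩ : ∃ j, k = j + 1 := ⟨k - 1, by omega⟩
    have h := sum_bruhatCell_one hψ hsq ha (2 * k + 1)
    rw [(symmUnitCount_fin_even_odd k).2, hF] at h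
    have hexp : (5 * (k + 1 + (k + 1)) ^ 2 - 6 * (k + 1 + (k + 1))) / 4
        = 2 * k + 1 + (2 * k + 1 + 1).choose 2 + (2 * k + 1).choose 2 + k * (k + 1) := by
      have h1 := two_mul_choose_two_add_self (2 * k + 1 + 1)
      have h2 := two_mul_choose_two_add_self (2 * k + 1)
      generalize (2 * k + 1 + 1).choose 2 = x at *
      generalize (2 * k + 1).choose 2 = y at *
      exact sub_div_four_eq (by nlinarith)
    rw [DC₁, A₁plus, hexp, show (k + 1 + (k + 1)) / 2 = k + 1 by omega,
      show k + 1 + (k + 1) - 1 = 2 * k + 1 by omega,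
      show k + 1 + (k + 1) = 2 * k + 1 + 1 by omega, h]
    ring
  · rintro n hn ⟨k, rfl⟩
    have h := sum_bruhatCell_one hψ hsq ha (2 * k)
    rw [(symmUnitCount_fin_even_odd k).1, hF] at h
    have hexp : (5 * (2 * k + 1) ^ 2 - 4 * (2 * k + 1) - 1) / 4
        = 2 * k + (2 * k + 1).choose 2 + (2 * k).choose 2 + k * (k + 1) := by
      have h1 := two_mul_choose_two_add_self (2 * k + 1)
      have h2 := two_mul_choose_two_add_self (2 * k)
      generalize (2 * k + 1).choose 2 = x at *
      generalize (2 * k).choose 2 = y at *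
      rw [Nat.sub_sub]
      exact sub_div_four_eq (by nlinarith)
    rw [DC₁, A₁minus, hexp, show (2 * k + 1 - 1) / 2 = k by omega, Nat.add_sub_cancel, h]
    ring
  · rintro n hn ⟨k, rfl⟩
    obtain ⟨k, rfl⟩ : ∃ j, k = j + 1 := ⟨k - 1, by omega⟩
    refine ⟨?_, by rw [hK₂]⟩
    have h := sum_bruhatCell_two hψ hsq ha (2 * k)
    rw [(symmUnitCount_fin_even_odd k).1, hF] at h
    have hexp : (5 * (k + 1 + (k + 1)) ^ 2 - 6 * (k + 1 + (k + 1))) / 4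
        = 2 * (2 * k) + 1 + (2 * k + 2).choose 2 + (2 * k).choose 2 + k * (k + 1) := by
      have h1 := two_mul_choose_two_add_self (2 * k + 2)
      have h2 := two_mul_choose_two_add_self (2 * k)
      generalize (2 * k + 2).choose 2 = x at *
      generalize (2 * k).choose 2 = y at *
      exact sub_div_four_eq (by nlinarith)
    rw [DC₂, A₂plus, hexp, show (k + 1 + (k + 1) - 2) / 2 = k by omega,
      show k + 1 + (k + 1) - 2 = 2 * k by omega,
      show k + 1 + (k + 1) = 2 * k + 2 by omega, h]
    ring
  · rintro n hn ⟨k, rfl⟩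
    obtain ⟨k, rfl⟩ : ∃ j, k = j + 1 := ⟨k - 1, by omega⟩
    refine ⟨?_, by rw [hK₂]⟩
    have h := sum_bruhatCell_two hψ hsq ha (2 * k + 1)
    rw [(symmUnitCount_fin_even_odd k).2, hF] at h
    -- the truncated difference `5 n² - 8 n` is harmless: it is nonnegative for `n ≥ 2`
    have hexp : (5 * (2 * (k + 1) + 1) ^ 2 - 8 * (2 * (k + 1) + 1) + 3) / 4
        = 2 * (2 * k + 1) + 1 + (2 * k + 1 + 2).choose 2 + (2 * k + 1).choose 2
          + k * (k + 1) := by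
      have h1 := two_mul_choose_two_add_self (2 * k + 1 + 2)
      have h2 := two_mul_choose_two_add_self (2 * k + 1)
      generalize (2 * k + 1 + 2).choose 2 = x at *
      generalize (2 * k + 1).choose 2 = y at *
      rw [← Nat.sub_add_comm (by nlinarith)]
      exact sub_div_four_eq (by nlinarith)
    rw [DC₂, A₂minus, hexp, show (2 * (k + 1) + 1 - 1) / 2 = k + 1 by omega,
      show 2 * (k + 1) + 1 - 2 = 2 * k + 1 by omega,
      show 2 * (k + 1) + 1 = 2 * k + 1 + 2 by omega, h]
    ring
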